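/- Let $n\ge 0$, let $\mathbb H$ be the quaternions with units $\mathbf i,\mathbf j,\mathbf k$, let $\mathrm{Sp}(n)=\{g\in M_n(\mathbb H): g^*g=gg^*=1\}$ with its usual Lie group structure, with Lie algebra $\mathfrak{sp}(n)=\{X: X^*=-X\}=T_1\mathrm{Sp}(n)$, and let $\mathrm{Sph}\subset \mathrm{Sp}(n)$ be the closed subgroup of diagonal matrices with unit quaternions on the diagonal. Let $p:\mathrm{Sp}(n)\to \mathrm{Sph}\backslash\mathrm{Sp}(n)$, $g\mapsto \mathrm{Sph}\,g$, and $p':\mathrm{Sp}(n)\to\mathrm{Sp}(n)/\mathrm{Sph}$, $g\mapsto g\,\mathrm{Sph}$, be the projections onto the manifolds of right and of left cosets. For $1\le r<s\le n$ let $E^{r,s}$ be the matrix with $(r,s)$ entry $1$, $(s,r)$ entry $-1$ and zeros elsewhere, and for $x\in\{\mathbf i,\mathbf j,\mathbf k\}$ let $S^{r,s}_x$ be the matrix with $(r,s)$ and $(s,r)$ entries $x$ and zeros elsewhere. Put $$\Lambda=\sum_{r<s}E^{r,s}\wedge S^{r,s}_{\mathbf i}\wedge S^{r,s}_{\mathbf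 j}\wedge S^{r,s}_{\mathbf k}\in\textstyle\bigwedge^4\mathfrak{sp}(n),\qquad \pi=\Lambda^L-\Lambda^R,$$ where $\Lambda^L(g)=(L_g)_*\Lambda$ and $\Lambda^R(g)=(R_g)_*\Lambda$ are the left and the right invariant 4-vector fields on $\mathrm{Sp}(n)$ with value $\Lambda$ at $1$ ($L_g$, $R_g$ being left and right multiplication by $g$). Then $\pi$ descends to both coset manifolds: there are well-defined 4-vector fields $\aleph$ on $\mathrm{Sph}\backslash\mathrm{Sp}(n)$ and $\aleph'$ on $\mathrm{Sp}(n)/\mathrm{Sph}$ (the Bruhat 4-vector field) with $\aleph(p(g))=p_*\pi(g)$ and $\aleph'(p'(g))=p'_*\pi(g)$ for all $g\in\mathrm{Sp}(n)$. The translation action $\beta(g,\mathrm{Sph}\,h)=\mathrm{Sph}\,hg$ of $\mathrm{Sp}(n)$ on $\mathrm{Sph}\backslash\mathrm{Sp}(n)$ is multiplicative with respect to $\pi\oplus\aleph$, and the translation action $\beta'(g,h\,\mathrm{Sph})=gh\,\mathrm{Sph}$ on $\mathrm{Sp}(n)/\mathrm{Sph}$ is multiplicative with respect to $\pi\oplus\aleph'$.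 That is, $\beta$ and $\beta'$ are smooth; $\pi$ is multiplicative, $\pi(gh)=(L_g)_*\pi(h)+(R_h)_*\pi(g)$ for all $g,h\in\mathrm{Sp}(n)$; and, writing $\beta_g=\beta(g,\cdot)$ and $\beta_x=\beta(\cdot,x)$, $$\aleph(\beta(g,x))=(\beta_g)_*\aleph(x)+(\beta_x)_*\pi(g)$$ for all $g\in\mathrm{Sp}(n)$ and all $x\in\mathrm{Sph}\backslash\mathrm{Sp}(n)$, and likewise for $\beta',\aleph'$ and all $x\in\mathrm{Sp}(n)/\mathrm{Sph}$. -/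

import Mathlib

open scoped Manifold ContDiff Quaternion

noncomputable section

set_option linter.unusedSectionVars false

section Cayley

variable {A : Type*} [NormedRing A] [NormedAlgebra ℝ A]

/-- The Cayley transform `X ↦ (1 + X / 2) (1 - X / 2)⁻¹`, normalised to have derivative `1` at `0`. -/
def cayley (X : A) : A := (1 + (1 / 2 : ℝ) • X) * Ring.inverse (1 - (1 / 2 : ℝ) • X)

/-- The inverse Cayley transform `a ↦ 2 (a - 1) (a + 1)⁻¹`. -/
def invCayley (a : A) : A := (2 : ℝ) • ((a - 1) * Ring.inverse (a + 1))

lemma ringInverse_eq_of_mul {A : Type*} [Ring A] {a b : A} (h : a * b = 1) (h' : b * a = 1) :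
    Ring.inverse a = b :=
  Ring.inverse_unit (⟨a, b, h, h'⟩ : Aˣ)

lemma invCayley_cayley {X : A} (h : IsUnit (1 - (1 / 2 : ℝ) • X)) :
    IsUnit (cayley X + 1) ∧ invCayley (cayley X) = X := by
  unfold invCayley cayley
  set y := (1 / 2 : ℝ) • X with hy
  set v := Ring.inverse (1 - y) with hv
  have h1 : (1 - y) * v = 1 := Ring.mul_inverse_cancel _ h
  have h2 : v * (1 - y) = 1 := Ring.inverse_mul_cancel _ h
  have h3 : (1 + y) * v + 1 = (2 : ℝ) • v := by
    have : (1 + y) * v + (1 - y) * v = v + v := by noncomm_ring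
    rwa [h1, ← two_smul ℝ v] at this
  have h4 : (1 + y) * v - 1 = (2 : ℝ) • (y * v) := by
    have : (1 + y) * v - (1 - y) * v = y * v + y * v := by noncomm_ring
    rwa [h1, ← two_smul ℝ (y * v)] at this
  have h5 : ((1 + y) * v + 1) * ((1 / 2 : ℝ) • (1 - y)) = 1 := by
    rw [h3, smul_mul_smul_comm, h2]; norm_num
  have h6 : ((1 / 2 : ℝ) • (1 - y)) * ((1 + y) * v + 1) = 1 := by
    rw [h3, smul_mul_smul_comm, h1]; norm_num
  refine ⟨⟨⟨_, _, h5, h6⟩, rfl⟩, ?_⟩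
  rw [ringInverse_eq_of_mul h5 h6, h4, smul_mul_smul_comm, mul_assoc, h2, hy]
  simp [smul_smul]

lemma cayley_invCayley {a : A} (h : IsUnit (a + 1)) :
    IsUnit (1 - (1 / 2 : ℝ) • invCayley a) ∧ cayley (invCayley a) = a := by
  unfold invCayley cayley
  set v := Ring.inverse (a + 1) with hv
  have h1 : (a + 1) * v = 1 := Ring.mul_inverse_cancel _ h
  have h2 : v * (a + 1) = 1 := Ring.inverse_mul_cancel _ h
  have e : (1 / 2 : ℝ) • (2 : ℝ) • ((a - 1) * v) = (a - 1) * v := by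
    rw [smul_smul]; norm_num
  rw [e]
  have h3 : 1 + (a - 1) * v = (2 : ℝ) • (a * v) := by
    have : (a + 1) * v + (a - 1) * v = a * v + a * v := by noncomm_ring
    rwa [h1, ← two_smul ℝ (a * v)] at this
  have h4 : 1 - (a - 1) * v = (2 : ℝ) • v := by
    have : (a + 1) * v - (a - 1) * v = v + v := by noncomm_ring
    rwa [h1, ← two_smul ℝ v] at this
  have h5 : (1 - (a - 1) * v) * ((1 / 2 : ℝ) • (a + 1)) = 1 := by
    rw [h4, smul_mul_smul_comm, h2]; norm_num
  have h6 : ((1 / 2 : ℝ) • (a + 1)) * (1 - (a - 1) * v) = 1 := by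
    rw [h4, smul_mul_smul_comm, h1]; norm_num
  refine ⟨⟨⟨_, _, h5, h6⟩, rfl⟩, ?_⟩
  rw [ringInverse_eq_of_mul h5 h6, h3, smul_mul_smul_comm, mul_assoc, h2]
  norm_num

variable [CompleteSpace A]

lemma contDiffAt_cayley {X : A} (h : IsUnit (1 - (1 / 2 : ℝ) • X)) :
    ContDiffAt ℝ ∞ (cayley : A → A) X := by
  obtain ⟨u, hu⟩ := h
  have hi : ContDiffAt ℝ ∞ Ring.inverse (1 - (1 / 2 : ℝ) • X) := hu ▸ contDiffAt_ringInverse ℝ u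
  unfold cayley
  exact (contDiffAt_const.add (contDiffAt_id.const_smul _)).mul
    (hi.comp X (contDiffAt_const.sub (contDiffAt_id.const_smul (1 / 2 : ℝ))))

lemma contDiffAt_invCayley {a : A} (h : IsUnit (a + 1)) :
    ContDiffAt ℝ ∞ (invCayley : A → A) a := by
  obtain ⟨u, hu⟩ := h
  have hi : ContDiffAt ℝ ∞ Ring.inverse (a + 1) := hu ▸ contDiffAt_ringInverse ℝ u
  unfold invCayley
  exact ((contDiffAt_id.sub contDiffAt_const).mul
    (hi.comp a (contDiffAt_id.add contDiffAt_const))).const_smul (2 : ℝ)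

lemma hasFDerivAt_cayley_zero :
    HasFDerivAt (cayley : A → A) (ContinuousLinearMap.id ℝ A) 0 := by
  have hi : HasFDerivAt (Ring.inverse : A → A) (-ContinuousLinearMap.id ℝ A)
      (1 - (1 / 2 : ℝ) • (0 : A)) := by
    have := hasFDerivAt_ringInverse (𝕜 := ℝ) (1 : Aˣ)
    convert this using 1
    · ext; simp
    · simp
  have h2 : HasFDerivAt (fun X : A => (1 / 2 : ℝ) • X) ((1 / 2 : ℝ) • ContinuousLinearMap.id ℝ A) 0 :=
    (hasFDerivAt_id (𝕜 := ℝ) (0 : A)).const_smul (1 / 2 : ℝ)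
  have := (h2.const_add 1).mul' (hi.comp (0 : A) (h2.const_sub 1))
  unfold cayley
  refine this.congr_fderiv ?_
  ext x
  simp [← add_smul]
  norm_num

lemma hasFDerivAt_invCayley_one :
    HasFDerivAt (invCayley : A → A) (ContinuousLinearMap.id ℝ A) 1 := by
  have h0 : IsUnit (1 - (1 / 2 : ℝ) • (0 : A)) := by simp
  have hc : cayley (0 : A) = 1 := by simp [cayley]
  have h1 : IsUnit ((1 : A) + 1) := by simpa [hc] using (invCayley_cayley h0).1
  have hd : DifferentiableAt ℝ (invCayley : A → A) (cayley 0) := by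
    rw [hc]; exact (contDiffAt_invCayley h1).differentiableAt (by simp)
  have key := hd.hasFDerivAt.comp (0 : A) hasFDerivAt_cayley_zero
  have ev : (invCayley ∘ cayley : A → A) =ᶠ[nhds 0] id := by
    have : ∀ᶠ X : A in nhds 0, IsUnit (1 - (1 / 2 : ℝ) • X) := by
      have hc : Continuous fun X : A => 1 - (1 / 2 : ℝ) • X := by fun_prop
      exact hc.continuousAt.eventually (Units.isOpen.mem_nhds h0)
    filter_upwards [this] with X hX using (invCayley_cayley hX).2
  have := (key.congr_of_eventuallyEq ev.symm).unique (hasFDerivAt_id (𝕜 := ℝ) (0 : A))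
  rw [hc] at this hd
  have h3 := hd.hasFDerivAt
  simpa using this ▸ h3

end Cayley

section UnitaryGroup

variable {A : Type*} [NormedRing A] [NormedAlgebra ℝ A] [StarRing A] [StarModule ℝ A]

variable (A) in
/-- The real vector space of skew-adjoint elements of `A`. -/
abbrev SkewAdj := skewAdjoint.submodule ℝ A

lemma skewAdj_star (X : SkewAdj A) : star (X : A) = -(X : A) := X.2

/-- Cayley transform, as an element of the unitary group
(with the value `1` where it is not defined). -/
def cayleyU (X : SkewAdj A) : unitary A := by
  classical
  exact if h : cayley (X : A) ∈ unitary A then ⟨cayley (X : A), h⟩ else 1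

lemma cayley_mem_unitary {X : SkewAdj A} (h : IsUnit (1 - (1 / 2 : ℝ) • (X : A))) :
    cayley (X : A) ∈ unitary A := by
  set y := (1 / 2 : ℝ) • (X : A) with hy
  have hs : star y = -y := by rw [hy, star_smul, skewAdj_star]; simp
  have h' : IsUnit (1 + y) := by
    have := h.star
    rwa [star_sub, hs, star_one, sub_neg_eq_add] at this
  set v := Ring.inverse (1 - y) with hv
  have h1 : (1 - y) * v = 1 := Ring.mul_inverse_cancel _ h
  have h2 : v * (1 - y) = 1 := Ring.inverse_mul_cancel _ h
  have hc : cayley (X : A) = (1 + y) * v := rfl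
  have hcu : IsUnit (cayley (X : A)) := hc ▸ h'.mul ⟨⟨v, 1 - y, h2, h1⟩, rfl⟩
  rw [hcu.mem_unitary_iff_star_mul_self, hc, star_mul, star_add, star_one, hs,
    ← sub_eq_add_neg]
  have h3 : star v * (1 + y) = 1 := by
    have := congrArg star h1
    rwa [star_mul, star_sub, hs, star_one, sub_neg_eq_add] at this
  have h4 : (1 - y) * (1 + y) = (1 + y) * (1 - y) := by noncomm_ring
  calc star v * (1 - y) * ((1 + y) * v) = star v * ((1 - y) * (1 + y)) * v := by noncomm_ring
    _ = (star v * (1 + y)) * ((1 - y) * v) := by rw [h4]; noncomm_ring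
    _ = 1 := by rw [h3, h1, one_mul]

lemma coe_cayleyU {X : SkewAdj A} (h : IsUnit (1 - (1 / 2 : ℝ) • (X : A))) :
    (cayleyU X : A) = cayley (X : A) := by
  simp [cayleyU, cayley_mem_unitary h]

lemma invCayley_mem_skewAdj {u : unitary A} (h : IsUnit ((u : A) + 1)) :
    star (invCayley (u : A)) = -invCayley (u : A) := by
  obtain ⟨a, ha⟩ : ∃ a : A, a = (u : A) := ⟨_, rfl⟩
  rw [← ha] at h ⊢
  set v := Ring.inverse (a + 1) with hv
  have h1 : (a + 1) * v = 1 := Ring.mul_inverse_cancel _ h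
  have h2 : v * (a + 1) = 1 := Ring.inverse_mul_cancel _ h
  have hu1 : star a * a = 1 := ha ▸ Unitary.coe_star_mul_self u
  have hc : invCayley a = (2 : ℝ) • ((a - 1) * v) := rfl
  have hcomm : (a - 1) * v = v * (a - 1) := by
    calc (a - 1) * v = (v * (a + 1)) * ((a - 1) * v) := by rw [h2, one_mul]
      _ = v * (a - 1) * ((a + 1) * v) := by noncomm_ring
      _ = _ := by rw [h1, mul_one]
  have h3 : star v * (star a + 1) = 1 := by
    have := congrArg star h1
    rwa [star_mul, star_add, star_one] at this
  have h5 : star v = a * v := by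
    have e : (star a + 1) * (a * v) = 1 := by
      calc (star a + 1) * (a * v) = (star a * a + a) * v := by noncomm_ring
        _ = 1 := by rw [hu1, add_comm, h1]
    calc star v = star v * ((star a + 1) * (a * v)) := by rw [e, mul_one]
      _ = (star v * (star a + 1)) * (a * v) := by noncomm_ring
      _ = a * v := by rw [h3, one_mul]
  rw [hc, hcomm, star_smul, star_mul, star_sub, star_one, h5, star_trivial, ← smul_neg, ← hcomm]
  congr 1
  calc (star a - 1) * (a * v) = (star a * a - a) * v := by noncomm_ring
    _ = _ := by rw [hu1]; noncomm_ring

variable [ContinuousStar A]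

/-- The projection `x ↦ (x - x⋆) / 2` onto the skew-adjoint elements. -/
def skewProj : A →L[ℝ] SkewAdj A where
  toFun x := ⟨(1 / 2 : ℝ) • (x - star x), by
    change star _ = -_
    rw [star_smul, star_sub, star_star, star_trivial, ← smul_neg, neg_sub]⟩
  map_add' x y := by
    apply Subtype.ext
    simp only [star_add, Submodule.coe_add, ← smul_add]
    congr 1; abel
  map_smul' r x := by
    apply Subtype.ext
    simp only [star_smul, star_trivial, ← smul_sub, RingHom.id_apply, Submodule.coe_smul]
    rw [smul_comm]
  cont := by
    apply Continuous.subtype_mk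
    fun_prop

lemma skewProj_of_star {x : A} (h : star x = -x) : (skewProj x : A) = x := by
  change (1 / 2 : ℝ) • (x - star x) = x
  rw [h, sub_neg_eq_add, ← two_smul ℝ x, smul_smul]; norm_num

@[simp] lemma skewProj_coe (X : SkewAdj A) : skewProj (X : A) = X :=
  Subtype.ext (skewProj_of_star X.2)

/-- The inverse Cayley transform on the unitary group. -/
def invCayleyU (u : unitary A) : SkewAdj A := skewProj (invCayley (u : A))

lemma coe_invCayleyU {u : unitary A} (h : IsUnit ((u : A) + 1)) :
    (invCayleyU u : A) = invCayley (u : A) :=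
  skewProj_of_star (invCayley_mem_skewAdj h)

lemma invCayleyU_cayleyU {X : SkewAdj A} (h : IsUnit (1 - (1 / 2 : ℝ) • (X : A))) :
    IsUnit ((cayleyU X : A) + 1) ∧ invCayleyU (cayleyU X) = X := by
  have := invCayley_cayley h
  unfold invCayleyU
  rw [coe_cayleyU h, this.2]
  exact ⟨this.1, skewProj_coe X⟩

lemma cayleyU_invCayleyU {u : unitary A} (h : IsUnit ((u : A) + 1)) :
    IsUnit (1 - (1 / 2 : ℝ) • (invCayleyU u : A)) ∧ cayleyU (invCayleyU u) = u := by
  have := cayley_invCayley h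
  have h1 : IsUnit (1 - (1 / 2 : ℝ) • (invCayleyU u : A)) := by
    rw [coe_invCayleyU h]; exact this.1
  refine ⟨h1, Subtype.ext ?_⟩
  rw [coe_cayleyU h1, coe_invCayleyU h, this.2]

variable [CompleteSpace A]

/-- The Cayley chart of the unitary group at the identity. -/
def cayleyChart : OpenPartialHomeomorph (unitary A) (SkewAdj A) where
  toFun := invCayleyU
  invFun := cayleyU
  source := {u | IsUnit ((u : A) + 1)}
  target := {X | IsUnit (1 - (1 / 2 : ℝ) • (X : A))}
  map_source' _ h := (cayleyU_invCayleyU h).1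
  map_target' _ h := (invCayleyU_cayleyU h).1
  left_inv' _ h := (cayleyU_invCayleyU h).2
  right_inv' _ h := (invCayleyU_cayleyU h).2
  open_source := Units.isOpen.preimage (by fun_prop : Continuous fun u : unitary A => (u : A) + 1)
  open_target := Units.isOpen.preimage
    (by fun_prop : Continuous fun X : SkewAdj A => 1 - (1 / 2 : ℝ) • (X : A))
  continuousOn_toFun := fun u h =>
    (skewProj.continuous.continuousAt.comp ((contDiffAt_invCayley h).continuousAt.comp
      continuous_subtype_val.continuousAt)).continuousWithinAt
  continuousOn_invFun := by
    rw [Topology.IsInducing.subtypeVal.continuousOn_iff]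
    have h : ContinuousOn (fun X : SkewAdj A => cayley (X : A))
        {X | IsUnit (1 - (1 / 2 : ℝ) • (X : A))} := fun X hX =>
      ((contDiffAt_cayley hX).continuousAt.comp
        continuous_subtype_val.continuousAt).continuousWithinAt
    exact h.congr fun X hX => coe_cayleyU hX

/-- The Cayley chart around `g`, namely `u ↦ 2 (g⁻¹ u - 1) (g⁻¹ u + 1)⁻¹`, with inverse
`X ↦ g (1 + X / 2) (1 - X / 2)⁻¹`. -/
def unitaryChart (g : unitary A) : OpenPartialHomeomorph (unitary A) (SkewAdj A) :=
  (Homeomorph.mulLeft g⁻¹).transOpenPartialHomeomorph cayleyChart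

/-- The smooth structure of the unitary group of `A`, given by Cayley charts. -/
instance unitaryChartedSpace : ChartedSpace (SkewAdj A) (unitary A) where
  atlas := Set.range unitaryChart
  chartAt g := unitaryChart g
  mem_chart_source g := by
    change IsUnit (((g⁻¹ * g : unitary A) : A) + 1)
    have := (invCayleyU_cayleyU (A := A) (X := 0) (by simp)).1
    have h1 : (cayleyU (0 : SkewAdj A) : A) = 1 := by
      rw [coe_cayleyU (by simp)]; simp [cayley]
    rw [h1] at this
    simpa using this
  chart_mem_atlas g := ⟨g, rfl⟩

instance unitaryIsManifold : IsManifold 𝓘(ℝ, SkewAdj A) ∞ (unitary A) := by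
  apply isManifold_of_contDiffOn
  rintro _ _ ⟨g, rfl⟩ ⟨h, rfl⟩ X ⟨hX, -⟩
  obtain ⟨h1, h2⟩ : X ∈ (unitaryChart g).target ∧
    (unitaryChart g).symm X ∈ (unitaryChart h).source := by simpa using hX
  replace h1 : IsUnit (1 - (1 / 2 : ℝ) • (X : A)) := h1
  replace h2 : IsUnit (((h⁻¹ * (g⁻¹⁻¹ * cayleyU X) : unitary A) : A) + 1) := h2
  rw [inv_inv, ← mul_assoc, Submonoid.coe_mul, coe_cayleyU h1] at h2
  have key : ContDiffAt ℝ ∞ (fun Y : SkewAdj A =>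
      skewProj (invCayley (((h⁻¹ * g : unitary A) : A) * cayley (Y : A)))) X := by
    have a1 : ContDiffAt ℝ ∞ (fun Y : SkewAdj A => cayley (Y : A)) X :=
      (contDiffAt_cayley h1).comp X (SkewAdj A).subtypeL.contDiff.contDiffAt
    have a2 : ContDiffAt ℝ ∞ (fun Y : SkewAdj A =>
      ((h⁻¹ * g : unitary A) : A) * cayley (Y : A)) X := contDiffAt_const.mul a1
    have a3 := (contDiffAt_invCayley h2).comp X a2
    exact skewProj.contDiff.contDiffAt.comp X a3
  apply key.contDiffWithinAt.congr_of_mem _ (by exact ⟨hX, by simp⟩)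
  rintro Y ⟨hY, -⟩
  have hY1 : IsUnit (1 - (1 / 2 : ℝ) • (Y : A)) := by
    have : Y ∈ (unitaryChart g).target ∧
      (unitaryChart g).symm Y ∈ (unitaryChart h).source := by simpa using hY
    exact this.1
  change skewProj (invCayley ((h⁻¹ * (g⁻¹⁻¹ * cayleyU Y) : unitary A) : A)) = _
  rw [inv_inv, ← mul_assoc, Submonoid.coe_mul, coe_cayleyU hY1]

/-- The inclusion of the unitary group into `A` is smooth. -/
lemma contMDiff_unitary_coe :
    ContMDiff 𝓘(ℝ, SkewAdj A) 𝓘(ℝ, A) ∞ (fun u : unitary A => (u : A)) := by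
  intro g
  rw [contMDiffAt_iff]
  refine ⟨continuous_subtype_val.continuousAt, ?_⟩
  have hg : chartAt (SkewAdj A) g g ∈ (unitaryChart g).target :=
    (unitaryChart g).map_source (mem_chart_source _ g)
  have h1 : IsUnit (1 - (1 / 2 : ℝ) • ((chartAt (SkewAdj A) g g : SkewAdj A) : A)) := hg
  have key : ContDiffAt ℝ ∞ (fun Y : SkewAdj A => (g : A) * cayley (Y : A))
      (chartAt (SkewAdj A) g g) :=
    contDiffAt_const.mul
      ((contDiffAt_cayley h1).comp _ (SkewAdj A).subtypeL.contDiff.contDiffAt)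
  simp only [mfld_simps]
  rw [contDiffWithinAt_univ]
  apply key.congr_of_eventuallyEq
  filter_upwards [(unitaryChart g).open_target.mem_nhds hg] with Y hY
  change ((g⁻¹⁻¹ * cayleyU Y : unitary A) : A) = _
  rw [inv_inv, Submonoid.coe_mul, coe_cayleyU hY]

/-- A map into the unitary group is smooth if it is smooth as a map into `A`. -/
lemma contMDiffAt_unitary_of_coe {E H M : Type*} [NormedAddCommGroup E] [NormedSpace ℝ E]
    [TopologicalSpace H] {I : ModelWithCorners ℝ E H} [TopologicalSpace M] [ChartedSpace H M]
    {f : M → unitary A} {x : M} (hf : ContMDiffAt I 𝓘(ℝ, A) ∞ (fun y => (f y : A)) x) :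
    ContMDiffAt I 𝓘(ℝ, SkewAdj A) ∞ f x := by
  rw [contMDiffAt_iff_target]
  refine ⟨Topology.IsInducing.subtypeVal.continuousAt_iff.2 hf.continuousAt, ?_⟩
  obtain ⟨g, hg⟩ : ∃ g, g = f x := ⟨_, rfl⟩
  rw [← hg]
  have h1 : IsUnit (((g⁻¹ : unitary A) : A) * (g : A) + 1) := mem_chart_source (SkewAdj A) g
  have key : ContDiffAt ℝ ∞ (fun a : A => skewProj (invCayley (((g⁻¹ : unitary A) : A) * a)))
      (g : A) := by
    have a1 : ContDiffAt ℝ ∞ (fun a : A => ((g⁻¹ : unitary A) : A) * a) (g : A) :=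
      contDiffAt_const.mul contDiffAt_id
    exact (skewProj (A := A)).contDiff.contDiffAt.comp (g : A)
      ((contDiffAt_invCayley h1).comp (g : A) a1)
  rw [hg] at key
  have := key.contMDiffAt.comp x (f := fun y => (f y : A)) hf
  rw [← hg] at this
  exact this

instance unitaryLieGroup : LieGroup 𝓘(ℝ, SkewAdj A) ∞ (unitary A) where
  contMDiff_mul p := by
    apply contMDiffAt_unitary_of_coe
    have h1 := contMDiff_unitary_coe.comp
      (contMDiff_fst (I := 𝓘(ℝ, SkewAdj A)) (J := 𝓘(ℝ, SkewAdj A)) (n := ∞)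
        (M := unitary A) (N := unitary A))
    have h2 := contMDiff_unitary_coe.comp
      (contMDiff_snd (I := 𝓘(ℝ, SkewAdj A)) (J := 𝓘(ℝ, SkewAdj A)) (n := ∞)
        (M := unitary A) (N := unitary A))
    exact ((contDiff_mul (𝕜 := ℝ) (𝔸 := A) (n := ∞)).contMDiff.comp (h1.prodMk_space h2)) p
  contMDiff_inv g := by
    apply contMDiffAt_unitary_of_coe
    exact ((starL' ℝ : A ≃L[ℝ] A).contDiff.contMDiff.comp contMDiff_unitary_coe) g

/-- Under the chart at the identity, a tangent vector `X` at `1` is the matrix `X`. -/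
lemma mfderiv_unitary_coe_one :
    mfderiv 𝓘(ℝ, SkewAdj A) 𝓘(ℝ, A) (fun u : unitary A => (u : A)) 1 = (SkewAdj A).subtypeL := by
  refine ((contMDiff_unitary_coe 1).mdifferentiableAt (by simp)).mfderiv.trans ?_
  simp only [mfld_simps]
  rw [fderivWithin_univ]
  have h0 : chartAt (SkewAdj A) (1 : unitary A) 1 = 0 := by
    change skewProj (invCayley ((1⁻¹ * 1 : unitary A) : A)) = 0
    simp [invCayley]
  rw [h0]
  have key : HasFDerivAt (fun Y : SkewAdj A => cayley (Y : A)) ((SkewAdj A).subtypeL) 0 := by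
    have := (hasFDerivAt_cayley_zero (A := A)).comp (0 : SkewAdj A)
      (SkewAdj A).subtypeL.hasFDerivAt
    exact this.congr_fderiv (ContinuousLinearMap.id_comp _)
  refine (key.congr_of_eventuallyEq ?_).fderiv
  have ht : (0 : SkewAdj A) ∈ (unitaryChart (1 : unitary A)).target := by
    change IsUnit (1 - (1 / 2 : ℝ) • ((0 : SkewAdj A) : A)); simp
  filter_upwards [(unitaryChart (1 : unitary A)).open_target.mem_nhds ht] with Y hY
  change ((1⁻¹⁻¹ * cayleyU Y : unitary A) : A) = _
  rw [inv_inv, one_mul, coe_cayleyU hY]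

end UnitaryGroup

section HomogeneousSpace

variable {A : Type*} [NormedRing A] [NormedAlgebra ℝ A] [StarRing A] [StarModule ℝ A]
  [ContinuousStar A] [CompleteSpace A]

instance skewAdj_completeSpace : CompleteSpace (SkewAdj A) := by
  have : IsClosed ((SkewAdj A : Submodule ℝ A) : Set A) :=
    isClosed_eq (continuous_star (R := A)) continuous_neg
  exact this.completeSpace_coe

/-- `ι` is the inclusion of a complement of the Lie algebra of the subgroup `S`, and `P` is a
projection to this complement, whose kernel is `S` in the Cayley chart at the identity. -/
structure IsSliceProj (S : Subgroup (unitary A)) {M : Type*} [NormedAddCommGroup M]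
    [NormedSpace ℝ M] (ι : M →L[ℝ] SkewAdj A) (P : SkewAdj A →L[ℝ] M) : Prop where
  left_inv : ∀ X, P (ι X) = X
  mem_iff : ∀ u : unitary A, IsUnit ((u : A) + 1) → (u ∈ S ↔ P (invCayleyU u) = 0)

namespace IsSliceProj

/-- The product of the Cayley transforms of the two components of `Z`. -/
def sliceMap (D : SkewAdj A →L[ℝ] SkewAdj A) (Z : SkewAdj A) : unitary A :=
  cayleyU (D Z) * cayleyU (Z - D Z)

/-- `sliceMap` in the Cayley chart. -/
def sliceFun (D : SkewAdj A →L[ℝ] SkewAdj A) (Z : SkewAdj A) : SkewAdj A :=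
  skewProj (invCayley (cayley (D Z : A) * cayley ((Z - D Z : SkewAdj A) : A)))

/-- The domain of `sliceFun`. -/
def sliceDom (D : SkewAdj A →L[ℝ] SkewAdj A) : Set (SkewAdj A) :=
  {Z | (IsUnit (1 - (1 / 2 : ℝ) • (D Z : A)) ∧
      IsUnit (1 - (1 / 2 : ℝ) • ((Z - D Z : SkewAdj A) : A))) ∧
    IsUnit (cayley (D Z : A) * cayley ((Z - D Z : SkewAdj A) : A) + 1)}

variable {D : SkewAdj A →L[ℝ] SkewAdj A}

lemma contDiffAt_prod {Z : SkewAdj A} (h1 : IsUnit (1 - (1 / 2 : ℝ) • (D Z : A)))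
    (h2 : IsUnit (1 - (1 / 2 : ℝ) • ((Z - D Z : SkewAdj A) : A))) :
    ContDiffAt ℝ ∞ (fun Z => cayley (D Z : A) * cayley ((Z - D Z : SkewAdj A) : A)) Z := by
  have a1 : ContDiffAt ℝ ∞ (fun Z => cayley (D Z : A)) Z :=
    (contDiffAt_cayley h1).comp Z ((SkewAdj A).subtypeL.comp D).contDiff.contDiffAt
  have a2 : ContDiffAt ℝ ∞ (fun Z => cayley ((Z - D Z : SkewAdj A) : A)) Z :=
    (contDiffAt_cayley h2).comp Z
      ((SkewAdj A).subtypeL.comp (ContinuousLinearMap.id ℝ _ - D)).contDiff.contDiffAt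
  exact a1.mul a2

lemma contDiffAt_skewProj_invCayley {a : A} (h : IsUnit (a + 1)) :
    ContDiffAt ℝ ∞ (fun a : A => skewProj (invCayley a)) a :=
  (skewProj (A := A)).contDiff.contDiffAt.comp a (contDiffAt_invCayley h)

lemma contDiffAt_sliceFun {Z : SkewAdj A} (h : Z ∈ sliceDom D) :
    ContDiffAt ℝ ∞ (sliceFun D) Z :=
  ContDiffAt.comp Z (g := fun a : A => skewProj (invCayley a))
    (contDiffAt_skewProj_invCayley h.2) (contDiffAt_prod h.1.1 h.1.2)

lemma isOpen_sliceDom : IsOpen (sliceDom D) := by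
  have hc1 : Continuous fun Z : SkewAdj A => 1 - (1 / 2 : ℝ) • (D Z : A) := by fun_prop
  have hc2 : Continuous fun Z : SkewAdj A => 1 - (1 / 2 : ℝ) • ((Z - D Z : SkewAdj A) : A) := by
    fun_prop
  refine ContinuousOn.isOpen_inter_preimage (s := {Z | IsUnit (1 - (1 / 2 : ℝ) • (D Z : A)) ∧
      IsUnit (1 - (1 / 2 : ℝ) • ((Z - D Z : SkewAdj A) : A))})
    (f := fun Z => cayley (D Z : A) * cayley ((Z - D Z : SkewAdj A) : A) + 1)
    (t := {a | IsUnit a}) ?_ ?_ Units.isOpen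
  · intro Z hZ
    exact ((contDiffAt_prod hZ.1 hZ.2).continuousAt.add continuousAt_const).continuousWithinAt
  · exact (Units.isOpen.preimage hc1).inter (Units.isOpen.preimage hc2)

lemma isUnit_two : IsUnit ((1 : A) + 1) := by
  have := (invCayley_cayley (A := A) (X := 0) (by simp)).1
  simpa [cayley] using this

lemma zero_mem_sliceDom : (0 : SkewAdj A) ∈ sliceDom D := by
  refine ⟨⟨by simp, by simp⟩, ?_⟩
  simpa [cayley] using isUnit_two (A := A)

lemma hasFDerivAt_sliceFun :
    HasFDerivAt (sliceFun D) (ContinuousLinearMap.id ℝ (SkewAdj A)) 0 := by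
  have e0 : (((0 : SkewAdj A) - D 0 : SkewAdj A) : A) = 0 := by simp
  have e1 : ((D 0 : SkewAdj A) : A) = 0 := by simp
  have c0 : cayley (0 : A) = 1 := by simp [cayley]
  have a1 : HasFDerivAt (fun Z => cayley (D Z : A)) ((SkewAdj A).subtypeL.comp D) 0 :=
    (HasFDerivAt.comp (0 : SkewAdj A) (g := (cayley : A → A))
      (f := fun Z => ((D Z : SkewAdj A) : A)) (g' := ContinuousLinearMap.id ℝ A)
      (e1.symm ▸ hasFDerivAt_cayley_zero)
      ((SkewAdj A).subtypeL.comp D).hasFDerivAt).congr_fderiv (ContinuousLinearMap.id_comp _)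
  have a2 : HasFDerivAt (fun Z => cayley ((Z - D Z : SkewAdj A) : A))
      ((SkewAdj A).subtypeL.comp (ContinuousLinearMap.id ℝ _ - D)) 0 :=
    (HasFDerivAt.comp (0 : SkewAdj A) (g := (cayley : A → A))
      (f := fun Z => ((Z - D Z : SkewAdj A) : A)) (g' := ContinuousLinearMap.id ℝ A)
      (e0.symm ▸ hasFDerivAt_cayley_zero)
      ((SkewAdj A).subtypeL.comp (ContinuousLinearMap.id ℝ _ - D)).hasFDerivAt).congr_fderiv
      (ContinuousLinearMap.id_comp _)
  have a3 := a1.mul' a2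
  have c1 : cayley ((D 0 : SkewAdj A) : A) * cayley (((0 : SkewAdj A) - D 0 : SkewAdj A) : A)
      = 1 := by rw [e0, e1, c0, one_mul]
  have a4 := HasFDerivAt.comp (0 : SkewAdj A) (g := (invCayley : A → A))
    (c1.symm ▸ hasFDerivAt_invCayley_one) a3
  have a5 := (skewProj (A := A)).hasFDerivAt.comp (0 : SkewAdj A) a4
  refine HasFDerivAt.congr_fderiv a5 ?_
  ext Z
  simp [c0]

lemma exists_slice (D : SkewAdj A →L[ℝ] SkewAdj A) :
    ∃ (O : Set (SkewAdj A)) (ψ : SkewAdj A → SkewAdj A),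
      IsOpen O ∧ 0 ∈ O ∧ O ⊆ sliceDom D ∧ (∀ Z ∈ O, ψ (sliceFun D Z) = Z) ∧
      (∀ O₁ ⊆ O, IsOpen O₁ → IsOpen (sliceFun D '' O₁)) ∧
      ∀ Z ∈ O, ContDiffAt ℝ ∞ ψ (sliceFun D Z) := by
  have h0 := contDiffAt_sliceFun (zero_mem_sliceDom (D := D))
  have hd : HasFDerivAt (sliceFun D)
      ((ContinuousLinearEquiv.refl ℝ (SkewAdj A) : SkewAdj A →L[ℝ] SkewAdj A)) 0 :=
    hasFDerivAt_sliceFun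
  set f := h0.toOpenPartialHomeomorph (sliceFun D) hd (by simp) with hf
  have hcd : ContinuousOn (fderiv ℝ (sliceFun D)) (sliceDom D) :=
    ContDiffOn.continuousOn_fderiv_of_isOpen
      (fun Z hZ => (contDiffAt_sliceFun hZ).contDiffWithinAt) isOpen_sliceDom
      (n := ∞) (by simp)
  have hopen := hcd.isOpen_inter_preimage isOpen_sliceDom
    (ContinuousLinearEquiv.isOpen (𝕜 := ℝ) (E := SkewAdj A) (F := SkewAdj A))
  refine ⟨f.source ∩ (sliceDom D ∩ fderiv ℝ (sliceFun D) ⁻¹' Set.range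
      ((↑) : (SkewAdj A ≃L[ℝ] SkewAdj A) → SkewAdj A →L[ℝ] SkewAdj A)), f.symm,
    f.open_source.inter hopen, ⟨?_, zero_mem_sliceDom, ?_⟩, fun Z hZ => hZ.2.1, ?_, ?_, ?_⟩
  · exact h0.mem_toOpenPartialHomeomorph_source hd (by simp)
  · exact ⟨_, hd.fderiv.symm⟩
  · intro Z hZ
    exact f.left_inv hZ.1
  · intro O₁ hO hO₁
    exact f.isOpen_image_of_subset_source hO₁ fun Z hZ => (hO hZ).1
  · rintro Z ⟨hZ, hZ2, e, he⟩
    have hs : f.symm (sliceFun D Z) = Z := f.left_inv hZ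
    refine f.contDiffAt_symm (f.map_source hZ) (f₀' := e) ?_ ?_
    · rw [hs]
      have := ((contDiffAt_sliceFun hZ2).differentiableAt (by simp)).hasFDerivAt
      rw [← he] at this
      exact this
    · rw [hs]; exact contDiffAt_sliceFun hZ2

lemma coe_sliceMap {Z : SkewAdj A} (h : Z ∈ sliceDom D) :
    (sliceMap D Z : A) = cayley (D Z : A) * cayley ((Z - D Z : SkewAdj A) : A) := by
  rw [sliceMap, Submonoid.coe_mul, coe_cayleyU h.1.1, coe_cayleyU h.1.2]

lemma invCayleyU_sliceMap {Z : SkewAdj A} (h : Z ∈ sliceDom D) :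
    IsUnit ((sliceMap D Z : A) + 1) ∧ invCayleyU (sliceMap D Z) = sliceFun D Z := by
  rw [invCayleyU, sliceFun, coe_sliceMap h]
  exact ⟨h.2, rfl⟩

lemma continuousAt_cayleyU {X : SkewAdj A} (h : IsUnit (1 - (1 / 2 : ℝ) • (X : A))) :
    ContinuousAt (cayleyU : SkewAdj A → unitary A) X :=
  (cayleyChart (A := A)).symm.continuousAt h

lemma invCayleyU_inj {u v : unitary A} (hu : IsUnit ((u : A) + 1)) (hv : IsUnit ((v : A) + 1))
    (h : invCayleyU u = invCayleyU v) : u = v := by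
  rw [← (cayleyU_invCayleyU hu).2, h, (cayleyU_invCayleyU hv).2]

variable {S : Subgroup (unitary A)}

variable {M : Type*} [NormedAddCommGroup M] [NormedSpace ℝ M]
  {ι : M →L[ℝ] SkewAdj A} {P : SkewAdj A →L[ℝ] M}

lemma cayleyU_mem (h : IsSliceProj S ι P) {Z : SkewAdj A} (hP : P Z = 0)
    (hZ : IsUnit (1 - (1 / 2 : ℝ) • (Z : A))) : cayleyU Z ∈ S := by
  obtain ⟨h1, h2⟩ := invCayleyU_cayleyU hZ
  rw [h.mem_iff _ h1, h2, hP]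

lemma exists_slice_nhds (hSD : IsSliceProj S ι P) {D : SkewAdj A →L[ℝ] SkewAdj A}
    (hD : D = ContinuousLinearMap.id ℝ _ - ι.comp P) {O : Set (SkewAdj A)} (hO : IsOpen O)
    (h0 : 0 ∈ O) (hOd : O ⊆ sliceDom D) (hinj : Set.InjOn (sliceFun D) O) :
    ∃ W : Set M, IsOpen W ∧ 0 ∈ W ∧ (∀ X ∈ W, (ι X) ∈ O) ∧
      ∀ X ∈ W, ∀ X' ∈ W, cayleyU (ι X) * (cayleyU (ι X'))⁻¹ ∈ S →
        X = X' := by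
  have hker : ∀ X : M, D (ι X) = 0 := fun X => by simp [hD, hSD.left_inv]
  have hDP : ∀ Z, P Z = 0 → D Z = Z := fun Z hZ => by simp [hD, hZ]
  have hu0 : IsUnit (1 - (1 / 2 : ℝ) • ((0 : SkewAdj A) : A)) := by simp
  have hc0 : cayleyU (0 : SkewAdj A) = 1 := by
    apply Subtype.ext; rw [coe_cayleyU hu0]; simp [cayley]
  -- the unitary quotient of two slice points
  let q : M × M → unitary A := fun p =>
    cayleyU (ι p.1) * (cayleyU (ι p.2))⁻¹
  have hq0 : q (0, 0) = 1 := by simp only [q, map_zero, hc0, inv_one, mul_one]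
  have hqc : ContinuousAt q (0, 0) := by
    have a1 : ContinuousAt (fun p : M × M => cayleyU (ι p.1)) (0, 0) :=
      ContinuousAt.comp (g := (cayleyU : SkewAdj A → unitary A))
        (f := fun p : M × M => (ι p.1)) (continuousAt_cayleyU (by simp))
        (by fun_prop)
    have a2 : ContinuousAt (fun p : M × M => cayleyU (ι p.2)) (0, 0) :=
      ContinuousAt.comp (g := (cayleyU : SkewAdj A → unitary A))
        (f := fun p : M × M => (ι p.2)) (continuousAt_cayleyU (by simp))
        (by fun_prop)
    exact a1.mul a2.inv
  have hu1 : (1 : unitary A) ∈ (cayleyChart (A := A)).source := by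
    change IsUnit (((1 : unitary A) : A) + 1)
    simpa using isUnit_two (A := A)
  have hi1 : invCayleyU (1 : unitary A) = 0 := by
    rw [← hc0]; exact (invCayleyU_cayleyU hu0).2
  have e1 : ∀ᶠ p in nhds ((0, 0) : M × M), q p ∈ (cayleyChart (A := A)).source :=
    hqc.eventually_mem (by rw [hq0]; exact (cayleyChart (A := A)).open_source.mem_nhds hu1)
  have e2 : ∀ᶠ p in nhds ((0, 0) : M × M),
      invCayleyU (q p) + (ι p.2) ∈ O := by
    have hcc : ContinuousAt (fun p => invCayleyU (q p)) ((0, 0) : M × M) :=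
      ContinuousAt.comp (g := (invCayleyU : unitary A → SkewAdj A)) (f := q)
        (by rw [hq0]; exact (cayleyChart (A := A)).continuousAt hu1) hqc
    have hcd : ContinuousAt (fun p : M × M => invCayleyU (q p) + (ι p.2))
        (0, 0) := hcc.add (by fun_prop)
    refine hcd.eventually_mem ?_
    rw [hq0, hi1]
    simpa using hO.mem_nhds h0
  have e3 : ∀ᶠ p in nhds ((0, 0) : M × M), (ι p.1) ∈ O := by
    have : ContinuousAt (fun p : M × M => (ι p.1)) (0, 0) := by fun_prop
    refine this.eventually_mem (hO.mem_nhds ?_)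
    simpa using h0
  have e := (e1.and e2).and e3
  rw [nhds_prod_eq] at e
  obtain ⟨W', hW', hWp⟩ := Filter.mem_prod_same_iff.1 e
  have hW : ∀ X ∈ W', ∀ X' ∈ W', (q (X, X') ∈ (cayleyChart (A := A)).source ∧
      invCayleyU (q (X, X')) + (ι X') ∈ O) ∧ (ι X) ∈ O :=
    fun X hX X' hX' => hWp (Set.mk_mem_prod hX hX')
  obtain ⟨W, hWW, hWo, hW0⟩ := mem_nhds_iff.1 hW'
  refine ⟨W, hWo, hW0, fun X hX => (hW X (hWW hX) X (hWW hX)).2, ?_⟩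
  intro X hX X' hX' hS
  obtain ⟨⟨h1, h2⟩, h3⟩ := hW X (hWW hX) X' (hWW hX')
  set Y := invCayleyU (q (X, X')) with hY
  have hDY : D Y = Y := hDP _ ((hSD.mem_iff _ h1).1 hS)
  have hDsum : D (Y + ι X') = Y := by rw [map_add, hDY, hker, add_zero]
  have hqY : cayleyU Y = q (X, X') := (cayleyU_invCayleyU h1).2
  have hm : sliceMap D (Y + ι X') = sliceMap D (ι X) := by
    rw [sliceMap, sliceMap, hDsum, hker, add_sub_cancel_left, hqY, hc0, sub_zero, one_mul]
    exact inv_mul_cancel_right _ _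
  have hf : sliceFun D (Y + ι X') = sliceFun D (ι X) := by
    rw [← (invCayleyU_sliceMap (hOd h2)).2, hm, (invCayleyU_sliceMap (hOd h3)).2]
  have := hinj h2 h3 hf
  have hY0 : Y = 0 := by rw [← hDsum, this, hker]
  rw [hY0, zero_add] at this
  rw [← hSD.left_inv X, ← this, hSD.left_inv]

end IsSliceProj

/-- The space `S \ U` of right cosets `S u` in the unitary group `U` of `A`. -/
abbrev RightCosets (S : Subgroup (unitary A)) := Quotient (QuotientGroup.rightRel S)

/-- The projection `u ↦ S u`. -/
def RightCosets.mk (S : Subgroup (unitary A)) (u : unitary A) : RightCosets S :=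
  Quotient.mk (QuotientGroup.rightRel S) u

lemma RightCosets.mk_eq {S : Subgroup (unitary A)} {u v : unitary A} :
    RightCosets.mk S u = RightCosets.mk S v ↔ v * u⁻¹ ∈ S :=
  Quotient.eq.trans QuotientGroup.rightRel_apply

lemma RightCosets.isOpenQuotientMap_mk (S : Subgroup (unitary A)) :
    IsOpenQuotientMap (RightCosets.mk S) :=
  MulAction.isOpenQuotientMap_quotientMk

namespace IsSliceProj

variable {S : Subgroup (unitary A)} {M : Type*} [NormedAddCommGroup M] [NormedSpace ℝ M]
  {ι : M →L[ℝ] SkewAdj A} {P : SkewAdj A →L[ℝ] M}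

theorem exists_chart (hSD : IsSliceProj S ι P) :
    ∃ e : OpenPartialHomeomorph (RightCosets S) M,
      RightCosets.mk S 1 ∈ e.source ∧
      (∀ X ∈ e.target, IsUnit (1 - (1 / 2 : ℝ) • ((ι X) : A)) ∧
        e.symm X = RightCosets.mk S (cayleyU (ι X))) ∧
      ∀ u, RightCosets.mk S u ∈ e.source → ∃ r : A → M, ContDiffAt ℝ ∞ r (u : A) ∧
        ∀ᶠ v : unitary A in nhds u, e (RightCosets.mk S v) = r (v : A) := by
  obtain ⟨D, hD⟩ : ∃ D, D = ContinuousLinearMap.id ℝ (SkewAdj A) - ι.comp P := ⟨_, rfl⟩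
  obtain ⟨O, ψ, hO, h0, hOd, hψ, hop, hsm⟩ := exists_slice D
  have hinj : Set.InjOn (sliceFun D) O := fun X hX Y hY h => by rw [← hψ X hX, h, hψ Y hY]
  obtain ⟨W, hW, hW0, hWO, hWS⟩ := exists_slice_nhds hSD hD hO h0 hOd hinj
  have hker : ∀ X : M, D (ι X) = 0 := fun X => by simp [hD, hSD.left_inv]
  have hc0 : cayleyU (0 : SkewAdj A) = 1 := by
    apply Subtype.ext; rw [coe_cayleyU (by simp)]; simp [cayley]
  have hPc : ContDiff ℝ ∞ (fun Z => P Z) := P.contDiff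
  have hP : ∀ Z, ι (P Z) = Z - D Z := fun Z => by simp [hD]
  have hPk : ∀ X : M, P (ι X) = X := hSD.left_inv
  have hPD : ∀ Z, P (D Z) = 0 := fun Z => by simp [hD, hSD.left_inv]
  have hWu : ∀ X ∈ W, IsUnit (1 - (1 / 2 : ℝ) • ((ι X) : A)) := fun X hX => by
    have := (hOd (hWO X hX)).1.2
    rwa [hker, sub_zero] at this
  have hslice : ∀ X : M, sliceMap D (ι X) = cayleyU (ι X) := fun X => by
    rw [sliceMap, hker, sub_zero, hc0, one_mul]
  let φ : M → RightCosets S := fun X => RightCosets.mk S (cayleyU (ι X))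
  have hφinj : Set.InjOn φ W := fun X hX Y hY h =>
    (hWS Y hY X hX (RightCosets.mk_eq.1 h)).symm
  have hφc : ContinuousOn φ W := fun X hX =>
    ((RightCosets.isOpenQuotientMap_mk S).continuous.continuousAt.comp
      (ContinuousAt.comp (g := (cayleyU : SkewAdj A → unitary A))
        (f := fun X : M => ι X) (continuousAt_cayleyU (hWu X hX))
        ι.continuous.continuousAt)).continuousWithinAt
  have hmk : ∀ Z ∈ O, RightCosets.mk S (sliceMap D Z) = φ (P Z) := fun Z hZ => by
    apply RightCosets.mk_eq.2
    rw [hP, sliceMap, mul_inv_rev, ← mul_assoc, mul_inv_cancel, one_mul]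
    exact S.inv_mem (cayleyU_mem hSD (hPD Z) (hOd hZ).1.1)
  -- images of open sets of slice coordinates are open in the group
  have hopenU : ∀ O₁ ⊆ O, IsOpen O₁ → IsOpen (sliceMap D '' O₁) := fun O₁ h1 h2 => by
    have h3 : sliceFun D '' O₁ ⊆ (cayleyChart (A := A)).target := by
      rintro _ ⟨Z, hZ, rfl⟩
      obtain ⟨a1, a2⟩ := invCayleyU_sliceMap (hOd (h1 hZ))
      rw [← a2]; exact (cayleyChart (A := A)).map_source a1
    have h4 : sliceMap D '' O₁ = (cayleyChart (A := A)).symm '' (sliceFun D '' O₁) := by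
      rw [Set.image_image]
      apply Set.image_congr
      intro Z hZ
      obtain ⟨a1, a2⟩ := invCayleyU_sliceMap (hOd (h1 hZ))
      rw [← a2]
      exact ((cayleyChart (A := A)).left_inv a1).symm
    rw [h4]
    exact (cayleyChart (A := A)).isOpen_image_symm_of_subset_target (hop O₁ h1 h2) h3
  have hφo : ∀ V ⊆ W, IsOpen V → IsOpen (φ '' V) := fun V hVW hV => by
    have h1 : IsOpen (O ∩ P ⁻¹' V) := hO.inter (hV.preimage P.continuous)
    have h2 := (RightCosets.isOpenQuotientMap_mk S).isOpenMap _
      (hopenU _ Set.inter_subset_left h1)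
    convert h2 using 1
    ext x
    constructor
    · rintro ⟨X, hX, rfl⟩
      exact ⟨_, ⟨(ι X), ⟨hWO X (hVW hX), by rw [Set.mem_preimage, hPk]; exact hX⟩, rfl⟩,
        by rw [hslice]⟩
    · rintro ⟨_, ⟨Z, ⟨hZ, hZ'⟩, rfl⟩, rfl⟩
      exact ⟨P Z, hZ', (hmk Z hZ).symm⟩
  let e0 : OpenPartialHomeomorph M (RightCosets S) :=
    OpenPartialHomeomorph.ofContinuousOpenRestrict (Set.InjOn.toPartialEquiv φ W hφinj) hφc
      (by
        intro V hV
        obtain ⟨V', hV', rfl⟩ := isOpen_induced_iff.1 hV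
        have h1 := hφo (W ∩ V') Set.inter_subset_left (hW.inter hV')
        convert h1 using 1
        ext x
        constructor
        · rintro ⟨⟨X, hX⟩, hX', rfl⟩
          exact ⟨X, ⟨hX, hX'⟩, rfl⟩
        · rintro ⟨X, ⟨hX, hX'⟩, rfl⟩
          exact ⟨⟨X, hX⟩, hX', rfl⟩) hW
  have he0 : ∀ X ∈ W, e0.symm (φ X) = X := fun X hX => e0.left_inv hX
  refine ⟨e0.symm, ?_, fun X hX => ⟨hWu X hX, rfl⟩, ?_⟩
  · have : φ 0 = RightCosets.mk S 1 := by simp only [φ, map_zero, hc0]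
    rw [← this]
    exact e0.map_source hW0
  · intro u hu
    set X := e0.symm (RightCosets.mk S u) with hX
    have hXW : X ∈ W := e0.map_target hu
    have hXu : φ X = RightCosets.mk S u := e0.right_inv hu
    -- the element of `S` moving `u` into the slice
    set s : unitary A := cayleyU (ι X) * u⁻¹ with hs
    have hsS : s ∈ S := by
      have := S.inv_mem (RightCosets.mk_eq.1 hXu)
      rwa [mul_inv_rev, inv_inv] at this
    have hsu : s * u = sliceMap D (ι X) := by rw [hslice, hs, inv_mul_cancel_right]
    obtain ⟨b1, b2⟩ := invCayleyU_sliceMap (hOd (hWO X hXW))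
    have hO' : IsOpen (O ∩ P ⁻¹' W) := hO.inter (hW.preimage P.continuous)
    have hXO' : (ι X) ∈ O ∩ P ⁻¹' W :=
      ⟨hWO X hXW, by rw [Set.mem_preimage, hPk]; exact hXW⟩
    refine ⟨fun a => P (ψ (skewProj (invCayley ((s : A) * a)))), ?_, ?_⟩
    · have c1 : ContDiffAt ℝ ∞ (fun a : A => (s : A) * a) (u : A) :=
        contDiffAt_const.mul contDiffAt_id
      have hval : (s : A) * (u : A) = (sliceMap D (ι X) : A) := by
        rw [← hsu]; rfl
      have c2 : ContDiffAt ℝ ∞ (fun a : A => skewProj (invCayley ((s : A) * a))) (u : A) :=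
        ContDiffAt.comp (u : A) (g := fun a : A => skewProj (invCayley a))
          (contDiffAt_skewProj_invCayley (by rw [hval]; exact b1)) c1
      have c3 : ContDiffAt ℝ ∞ ψ (skewProj (invCayley ((s : A) * (u : A)))) := by
        rw [hval]
        change ContDiffAt ℝ ∞ ψ (invCayleyU (sliceMap D (ι X)))
        rw [b2]
        exact hsm _ (hWO X hXW)
      exact hPc.contDiffAt.comp (u : A) (ContDiffAt.comp (u : A) (g := ψ) c3 c2)
    · have hcont : Continuous fun v : unitary A => s * v := continuous_const.mul continuous_id
      have d1 : ∀ᶠ v in nhds u, s * v ∈ sliceMap D '' (O ∩ P ⁻¹' W) := by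
        apply hcont.continuousAt.eventually_mem
        apply (hopenU _ Set.inter_subset_left hO').mem_nhds
        rw [hsu]
        exact ⟨_, hXO', rfl⟩
      filter_upwards [d1] with v ⟨Z, ⟨hZ, hZW⟩, hZv⟩
      have g1 : RightCosets.mk S v = φ (P Z) := by
        rw [← hmk Z hZ, hZv]
        apply RightCosets.mk_eq.2
        rw [mul_inv_cancel_right]; exact hsS
      rw [g1, he0 _ hZW, ← Submonoid.coe_mul, ← hZv]
      change _ = P (ψ (invCayleyU (sliceMap D Z)))
      rw [(invCayleyU_sliceMap (hOd hZ)).2, hψ Z hZ]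

end IsSliceProj

/-- The right translation `(S u, g) ↦ S u g` on right cosets. -/
def RightCosets.transl {S : Subgroup (unitary A)} (x : RightCosets S) (g : unitary A) :
    RightCosets S :=
  Quotient.map (· * g) (fun u v h => by
    change QuotientGroup.rightRel S _ _
    rw [QuotientGroup.rightRel_apply, mul_inv_rev, ← mul_assoc, mul_inv_cancel_right]
    exact QuotientGroup.rightRel_apply.1 h) x

lemma RightCosets.transl_mk {S : Subgroup (unitary A)} (u g : unitary A) :
    (RightCosets.mk S u).transl g = RightCosets.mk S (u * g) := rfl

lemma RightCosets.transl_transl {S : Subgroup (unitary A)} (x : RightCosets S)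
    (g h : unitary A) : (x.transl g).transl h = x.transl (g * h) := by
  obtain ⟨u, rfl⟩ := Quotient.exists_rep x
  exact congrArg (RightCosets.mk S) (mul_assoc u g h)

lemma RightCosets.transl_one {S : Subgroup (unitary A)} (x : RightCosets S) : x.transl 1 = x := by
  obtain ⟨u, rfl⟩ := Quotient.exists_rep x
  exact congrArg (RightCosets.mk S) (mul_one u)

lemma RightCosets.continuous_transl {S : Subgroup (unitary A)} (g : unitary A) :
    Continuous fun x : RightCosets S => x.transl g :=
  (RightCosets.isOpenQuotientMap_mk S).isQuotientMap.continuous_iff.2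
    ((RightCosets.isOpenQuotientMap_mk S).continuous.comp (continuous_mul_const g))

/-- Right translation by `g` as a homeomorphism. -/
def RightCosets.translHomeo {S : Subgroup (unitary A)} (g : unitary A) :
    RightCosets S ≃ₜ RightCosets S where
  toFun x := x.transl g
  invFun x := x.transl g⁻¹
  left_inv x := by simp only [RightCosets.transl_transl, mul_inv_cancel, RightCosets.transl_one]
  right_inv x := by simp only [RightCosets.transl_transl, inv_mul_cancel, RightCosets.transl_one]
  continuous_toFun := RightCosets.continuous_transl g
  continuous_invFun := RightCosets.continuous_transl g⁻¹

/-- The inversion `u S ↦ S u⁻¹` from left cosets to right cosets. -/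
def RightCosets.ofLeft (S : Subgroup (unitary A)) : (unitary A ⧸ S) ≃ₜ RightCosets S where
  toEquiv := (QuotientGroup.quotientRightRelEquivQuotientLeftRel S).symm
  continuous_toFun :=
    (QuotientGroup.isOpenQuotientMap_mk (N := S)).isQuotientMap.continuous_iff.2
      ((RightCosets.isOpenQuotientMap_mk S).continuous.comp continuous_inv)
  continuous_invFun :=
    (RightCosets.isOpenQuotientMap_mk S).isQuotientMap.continuous_iff.2
      (QuotientGroup.continuous_mk.comp continuous_inv)

namespace IsSliceProj

variable {S : Subgroup (unitary A)} {M : Type*} [NormedAddCommGroup M] [NormedSpace ℝ M]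
  {ι : M →L[ℝ] SkewAdj A} {P : SkewAdj A →L[ℝ] M}

/-- The chart of `S \ U` at the coset of `1`, with inverse `X ↦ S (1 + X / 2) (1 - X / 2)⁻¹` for `X`
in a small neighbourhood of `0` in the complement. -/
def baseChart (h : IsSliceProj S ι P) : OpenPartialHomeomorph (RightCosets S) M :=
  Classical.choose h.exists_chart

/-- The chart of `S \ U` around `S g`, with inverse `X ↦ S (1 + X / 2) (1 - X / 2)⁻¹ g`. -/
def chart (h : IsSliceProj S ι P) (g : unitary A) : OpenPartialHomeomorph (RightCosets S) M :=
  (RightCosets.translHomeo g⁻¹).transOpenPartialHomeomorph h.baseChart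

lemma one_mem_baseChart (h : IsSliceProj S ι P) : RightCosets.mk S 1 ∈ h.baseChart.source :=
  (Classical.choose_spec h.exists_chart).1

lemma baseChart_symm (h : IsSliceProj S ι P) {X : M} (hX : X ∈ h.baseChart.target) :
    IsUnit (1 - (1 / 2 : ℝ) • (ι X : A)) ∧ h.baseChart.symm X = RightCosets.mk S (cayleyU (ι X)) :=
  (Classical.choose_spec h.exists_chart).2.1 X hX

lemma baseChart_mk (h : IsSliceProj S ι P) {u : unitary A}
    (hu : RightCosets.mk S u ∈ h.baseChart.source) :
    ∃ r : A → M, ContDiffAt ℝ ∞ r (u : A) ∧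
      ∀ᶠ v : unitary A in nhds u, h.baseChart (RightCosets.mk S v) = r (v : A) :=
  (Classical.choose_spec h.exists_chart).2.2 u hu

/-- The smooth structure of the homogeneous space `S \ U` of right cosets. -/
@[reducible] def chartedSpace (h : IsSliceProj S ι P) : ChartedSpace M (RightCosets S) where
  atlas := Set.range h.chart
  chartAt x := h.chart (Quotient.out x)
  mem_chart_source x := by
    change (x.transl (Quotient.out x)⁻¹) ∈ h.baseChart.source
    have hx : x = RightCosets.mk S (Quotient.out x) := (Quotient.out_eq x).symm
    have : x.transl (Quotient.out x)⁻¹ = RightCosets.mk S 1 := by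
      conv_lhs => rw [hx]
      rw [RightCosets.transl_mk, ← hx, mul_inv_cancel]
    rw [this]; exact h.one_mem_baseChart
  chart_mem_atlas x := ⟨_, rfl⟩

lemma contDiffAt_transition (h : IsSliceProj S ι P) (g k : unitary A) {X : M}
    (hX : X ∈ ((h.chart g).symm ≫ₕ h.chart k).source) :
    ContDiffAt ℝ ∞ ((h.chart g).symm ≫ₕ h.chart k) X := by
  obtain ⟨h1, h2⟩ : X ∈ h.baseChart.target ∧
      ((h.baseChart.symm X).transl g⁻¹⁻¹).transl k⁻¹ ∈ h.baseChart.source := by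
    have : X ∈ (h.chart g).target ∧ (h.chart g).symm X ∈ (h.chart k).source := by simpa using hX
    exact this
  obtain ⟨a1, a2⟩ := h.baseChart_symm h1
  rw [a2, RightCosets.transl_mk, RightCosets.transl_mk] at h2
  obtain ⟨r, hr, hr'⟩ := h.baseChart_mk h2
  have hc : ContinuousAt (fun Y : M => cayleyU (ι Y) * g⁻¹⁻¹ * k⁻¹) X :=
    ((ContinuousAt.comp (g := (cayleyU : SkewAdj A → unitary A)) (f := ι)
      (continuousAt_cayleyU a1) ι.continuous.continuousAt).mul continuousAt_const).mul
        continuousAt_const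
  have key : ContDiffAt ℝ ∞ (fun Y : M =>
      r (cayley (ι Y : A) * ((g⁻¹⁻¹ : unitary A) : A) * ((k⁻¹ : unitary A) : A))) X := by
    have b1 : ContDiffAt ℝ ∞ (fun Y : M => cayley (ι Y : A)) X :=
      (contDiffAt_cayley a1).comp X ((SkewAdj A).subtypeL.comp ι).contDiff.contDiffAt
    refine ContDiffAt.comp X (g := r) ?_ ((b1.mul contDiffAt_const).mul contDiffAt_const)
    rw [Submonoid.coe_mul, Submonoid.coe_mul, coe_cayleyU a1] at hr
    exact hr
  apply key.congr_of_eventuallyEq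
  filter_upwards [h.baseChart.open_target.mem_nhds h1, hc.eventually hr'] with Y hY hY'
  obtain ⟨c1, c2⟩ := h.baseChart_symm hY
  rw [Submonoid.coe_mul, Submonoid.coe_mul, coe_cayleyU c1] at hY'
  rw [← hY']
  change h.baseChart (((h.baseChart.symm Y).transl g⁻¹⁻¹).transl k⁻¹) = _
  rw [c2, RightCosets.transl_mk, RightCosets.transl_mk]

theorem isManifold (h : IsSliceProj S ι P) :
    letI := h.chartedSpace
    IsManifold 𝓘(ℝ, M) ∞ (RightCosets S) := by
  let _ := h.chartedSpace
  apply isManifold_of_contDiffOn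
  rintro _ _ ⟨g, rfl⟩ ⟨k, rfl⟩ X ⟨hX, -⟩
  exact (h.contDiffAt_transition g k hX).contDiffWithinAt

/-- The projection `U → S \ U` is smooth. -/
theorem contMDiff_mk (h : IsSliceProj S ι P) :
    letI := h.chartedSpace
    ContMDiff 𝓘(ℝ, SkewAdj A) 𝓘(ℝ, M) ∞ (RightCosets.mk S) := by
  let _ := h.chartedSpace
  intro u
  rw [contMDiffAt_iff_target]
  refine ⟨(RightCosets.isOpenQuotientMap_mk S).continuous.continuousAt, ?_⟩
  obtain ⟨g, hg⟩ : ∃ g : unitary A, chartAt M (RightCosets.mk S u) = h.chart g := ⟨_, rfl⟩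
  have hs : RightCosets.mk S (u * g⁻¹) ∈ h.baseChart.source := by
    have := mem_chart_source M (RightCosets.mk S u)
    rw [hg] at this
    exact this
  obtain ⟨r, hr, hr'⟩ := h.baseChart_mk hs
  have hc : ContMDiff 𝓘(ℝ, SkewAdj A) 𝓘(ℝ, A) ∞
      (fun v : unitary A => ((v * g⁻¹ : unitary A) : A)) :=
    contMDiff_unitary_coe.comp contMDiff_mul_right
  have key : ContMDiffAt 𝓘(ℝ, SkewAdj A) 𝓘(ℝ, M) ∞
      (fun v : unitary A => r ((v * g⁻¹ : unitary A) : A)) u :=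
    ContMDiffAt.comp u (g := r) hr.contMDiffAt (hc u)
  apply key.congr_of_eventuallyEq
  filter_upwards [(continuous_mul_const g⁻¹).continuousAt.eventually hr'] with v hv
  rw [← hv]
  simp only [mfld_simps, hg]
  rfl

/-- The smooth structure of the homogeneous space `U / S` of left cosets, for which the inversion
`u S ↦ S u⁻¹` is a diffeomorphism to `S \ U`. -/
@[reducible] def chartedSpaceLeft (h : IsSliceProj S ι P) : ChartedSpace M (unitary A ⧸ S) where
  atlas := Set.range fun g => (RightCosets.ofLeft S).transOpenPartialHomeomorph (h.chart g)
  chartAt x := (RightCosets.ofLeft S).transOpenPartialHomeomorph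
    (h.chart (Quotient.out (RightCosets.ofLeft S x)))
  mem_chart_source x := by
    let _ := h.chartedSpace
    exact mem_chart_source M (RightCosets.ofLeft S x)
  chart_mem_atlas x := ⟨_, rfl⟩

theorem isManifold_left (h : IsSliceProj S ι P) :
    letI := h.chartedSpaceLeft
    IsManifold 𝓘(ℝ, M) ∞ (unitary A ⧸ S) := by
  let _ := h.chartedSpaceLeft
  apply isManifold_of_contDiffOn
  rintro _ _ ⟨g, rfl⟩ ⟨k, rfl⟩ X ⟨hX, -⟩
  have e : ∀ Y, (RightCosets.ofLeft S) ((RightCosets.ofLeft S).symm Y) = Y :=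
    (RightCosets.ofLeft S).apply_symm_apply
  have hX' : X ∈ ((h.chart g).symm ≫ₕ h.chart k).source := by
    simpa [e] using hX
  have := (h.contDiffAt_transition g k hX').contDiffWithinAt (s := Set.univ)
  have h2 := h.contDiffAt_transition g k hX'
  apply ContDiffAt.contDiffWithinAt
  convert h2 using 1
  ext Y
  simp [e]

theorem contMDiff_mk_left (h : IsSliceProj S ι P) :
    letI := h.chartedSpaceLeft
    ContMDiff 𝓘(ℝ, SkewAdj A) 𝓘(ℝ, M) ∞ (QuotientGroup.mk : unitary A → unitary A ⧸ S) := by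
  let _ := h.chartedSpaceLeft
  let _ := h.chartedSpace
  intro u
  rw [contMDiffAt_iff_target]
  refine ⟨QuotientGroup.continuous_mk.continuousAt, ?_⟩
  have h1 := h.contMDiff_mk.comp (contMDiff_inv 𝓘(ℝ, SkewAdj A) ∞)
  have h2 := contMDiffAt_iff_target.1 (h1 u)
  exact h2.2

end IsSliceProj

end HomogeneousSpace

end

/-- The real algebra `𝔤𝔩(n, ℍ)` of quaternionic `n × n` matrices, with the conjugate transpose as
star operation. -/
abbrev QMat (n : ℕ) : Type := Matrix (Fin n) (Fin n) ℍ[ℝ]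

-- Any norm would do here: it is only used for the topology and for differentiation.
attribute [local instance] Matrix.linftyOpNormedRing Matrix.linftyOpNormedAlgebra

noncomputable section

section QuaternionicUnitary

instance qMatUniformSpace (n : ℕ) : UniformSpace (QMat n) :=
  (inferInstance : PseudoMetricSpace (QMat n)).toUniformSpace

instance qMatTopologicalSpace (n : ℕ) : TopologicalSpace (QMat n) :=
  (inferInstance : PseudoMetricSpace (QMat n)).toUniformSpace.toTopologicalSpace

instance (n : ℕ) : StarModule ℝ (QMat n) where
  star_smul r X := by
    apply Matrix.ext
    intro i j
    exact Quaternion.star_smul r (X j i)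

instance (n : ℕ) : ContinuousStar (QMat n) where
  continuous_star :=
    let f : QMat n →ₗ[ℝ] QMat n :=
      { toFun := star, map_add' := star_add, map_smul' := fun r X => by simp [star_smul] }
    f.continuous_of_finiteDimensional

/-- The compact symplectic group `Sp(n)` of quaternionic matrices `g` with `g⋆ g = g g⋆ = 1`. It is
a Lie group with the instance `unitaryLieGroup`. -/
abbrev Sp (n : ℕ) := unitary (QMat n)

/-- A matrix is diagonal if and only if it commutes with the diagonal matrix units. -/
lemma commute_diagonal_iff {n : ℕ} (X : QMat n) :
    (∀ k, Commute (Matrix.diagonal fun i => if i = k then (1 : ℍ[ℝ]) else 0) X) ↔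
      ∀ i j, i ≠ j → X i j = 0 := by
  constructor
  · intro h i j hij
    have := congrArg (fun Y : QMat n => Y i j) (h i).eq
    simpa [Matrix.diagonal_mul, Matrix.mul_diagonal, hij, hij.symm] using this
  · intro h k
    apply Matrix.ext
    intro i j
    by_cases hij : i = j
    · subst hij
      simp
    · simp [h i j hij]

variable (n : ℕ)

/-- The spheroid `Sph = Sp(1)^n` of diagonal matrices with unit quaternions on the diagonal. -/
def Sph : Subgroup (Sp n) where
  carrier := {u | ∃ d : Fin n → unitary ℍ[ℝ], (u : QMat n) = Matrix.diagonal fun i => (d i : ℍ[ℝ])}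
  one_mem' := ⟨fun _ => 1, Matrix.diagonal_one.symm⟩
  mul_mem' := by
    rintro u v ⟨d, hd⟩ ⟨d', hd'⟩
    exact ⟨fun i => d i * d' i, by rw [Submonoid.coe_mul, hd, hd', Matrix.diagonal_mul_diagonal]; rfl⟩
  inv_mem' := by
    rintro u ⟨d, hd⟩
    exact ⟨fun i => star (d i), by
      rw [← Unitary.star_eq_inv, Unitary.coe_star, hd, Matrix.star_eq_conjTranspose, Matrix.diagonal_conjTranspose]; rfl⟩

/-- The skew-adjoint quaternionic matrices with zero diagonal: the orthogonal complement in `𝔰𝔭(n)`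
of the Lie algebra of `Sph`, and the model space of the flag manifold. -/
abbrev FlagModel : Submodule ℝ (QMat n) where
  carrier := {X | star X = -X ∧ ∀ i, X i i = 0}
  add_mem' := fun ⟨h1, h2⟩ ⟨h3, h4⟩ =>
    ⟨by rw [star_add, h1, h3, neg_add], fun i => by simp [h2, h4]⟩
  zero_mem' := ⟨by simp, fun i => by simp⟩
  smul_mem' := fun r X ⟨h1, h2⟩ => ⟨by simp [star_smul, h1], fun i => by simp [h2]⟩

/-- The inclusion of `FlagModel n` into `𝔰𝔭(n)`. -/
def flagIncl : FlagModel n →L[ℝ] SkewAdj (QMat n) :=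
  LinearMap.toContinuousLinearMap
    (Submodule.inclusion (show FlagModel n ≤ SkewAdj (QMat n) from fun _ h => h.1))

/-- The projection from `𝔰𝔭(n)` to `FlagModel n` which removes the diagonal. -/
def flagProj : SkewAdj (QMat n) →L[ℝ] FlagModel n :=
  LinearMap.toContinuousLinearMap
    { toFun := fun X => ⟨Matrix.of fun i j => if i = j then 0 else (X : QMat n) i j, by
        constructor
        · apply Matrix.ext
          intro i j
          have := congrArg (fun Y : QMat n => Y i j) X.2
          by_cases h : i = j
          · simp [h]
          · simpa [h, Ne.symm h] using this
        · intro i; simp⟩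
      map_add' := fun X Y => by
        apply Subtype.ext
        apply Matrix.ext
        intro i j
        by_cases h : i = j <;> simp [h]
      map_smul' := fun r X => by
        apply Subtype.ext
        apply Matrix.ext
        intro i j
        by_cases h : i = j <;> simp [h] }

theorem isSliceProj_sph : IsSliceProj (Sph n) (flagIncl n) (flagProj n) where
  left_inv X := by
    apply Subtype.ext
    apply Matrix.ext
    intro i j
    change (if i = j then 0 else (X : QMat n) i j) = _
    split_ifs with h
    · rw [h]; exact (X.2.2 j).symm
    · rfl
  mem_iff u hu := by
    have hP : flagProj n (invCayleyU u) = 0 ↔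
        ∀ i j, i ≠ j → (invCayley (u : QMat n)) i j = 0 := by
      rw [← coe_invCayleyU hu]
      constructor
      · intro h i j hij
        have := congrArg (fun Y : FlagModel n => (Y : QMat n) i j) h
        change (if i = j then 0 else (invCayleyU u : QMat n) i j) = 0 at this
        rwa [if_neg hij] at this
      · intro h
        apply Subtype.ext
        apply Matrix.ext
        intro i j
        change (if i = j then 0 else (invCayleyU u : QMat n) i j) = 0
        split_ifs with hij
        · rfl
        · exact h i j hij
    have hcomm : ∀ {a b : QMat n}, Commute a b → Commute a (Ring.inverse b) := by
      intro a b hab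
      by_cases hb : IsUnit b
      · obtain ⟨v, rfl⟩ := hb
        rw [Ring.inverse_unit]
        exact hab.units_inv_right
      · rw [Ring.inverse_non_unit _ hb]; exact Commute.zero_right a
    have hS : u ∈ Sph n ↔ ∀ i j, i ≠ j → (u : QMat n) i j = 0 := by
      constructor
      · rintro ⟨d, hd⟩ i j hij
        rw [hd, Matrix.diagonal_apply, if_neg hij]
      · intro h
        have hd : (u : QMat n) = Matrix.diagonal fun i => (u : QMat n) i i := by
          apply Matrix.ext
          intro i j
          rw [Matrix.diagonal_apply]
          split_ifs with hij
          · rw [hij]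
          · exact h i j hij
        have h1 : star (u : QMat n) * (u : QMat n) = 1 := u.2.1
        have h2 : (u : QMat n) * star (u : QMat n) = 1 := u.2.2
        rw [hd, Matrix.star_eq_conjTranspose, Matrix.diagonal_conjTranspose, Matrix.diagonal_mul_diagonal] at h1 h2
        refine ⟨fun i => ⟨(u : QMat n) i i, ?_, ?_⟩, hd⟩
        · have := congrArg (fun Y : QMat n => Y i i) h1
          simpa [Matrix.diagonal_apply, Matrix.one_apply] using this
        · have := congrArg (fun Y : QMat n => Y i i) h2
          simpa [Matrix.diagonal_apply, Matrix.one_apply] using this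
    rw [hP, hS, ← commute_diagonal_iff, ← commute_diagonal_iff]
    refine forall_congr' fun k => ⟨fun h => ?_, fun h => ?_⟩
    · exact ((h.sub_right (Commute.one_right _)).mul_right
        (hcomm (h.add_right (Commute.one_right _)))).smul_right _
    · rw [← (cayley_invCayley hu).2]
      exact ((Commute.one_right _).add_right (h.smul_right _)).mul_right
        (hcomm ((Commute.one_right _).sub_right (h.smul_right _)))

/-- The quaternionic flag manifold `Sph \ Sp(n)` of right cosets `Sph g`. -/
abbrev FlagManifold := RightCosets (Sph n)

/-- The manifold `Sp(n) / Sph` of left cosets `g Sph`. -/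
abbrev LeftFlagManifold := Sp n ⧸ Sph n

instance : ChartedSpace (FlagModel n) (FlagManifold n) := (isSliceProj_sph n).chartedSpace

instance : IsManifold 𝓘(ℝ, FlagModel n) ∞ (FlagManifold n) := (isSliceProj_sph n).isManifold

instance : ChartedSpace (FlagModel n) (LeftFlagManifold n) := (isSliceProj_sph n).chartedSpaceLeft

instance : IsManifold 𝓘(ℝ, FlagModel n) ∞ (LeftFlagManifold n) := (isSliceProj_sph n).isManifold_left

theorem contMDiff_flag_mk :
    ContMDiff 𝓘(ℝ, SkewAdj (QMat n)) 𝓘(ℝ, FlagModel n) ∞ (RightCosets.mk (Sph n)) :=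
  (isSliceProj_sph n).contMDiff_mk

theorem contMDiff_leftFlag_mk :
    ContMDiff 𝓘(ℝ, SkewAdj (QMat n)) 𝓘(ℝ, FlagModel n) ∞
      (QuotientGroup.mk : Sp n → LeftFlagManifold n) :=
  (isSliceProj_sph n).contMDiff_mk_left

end QuaternionicUnitary

section FourVectors

variable {E H M : Type*} [NormedAddCommGroup E] [NormedSpace ℝ E] [TopologicalSpace H]
  (I : ModelWithCorners ℝ E H) [TopologicalSpace M] [ChartedSpace H M]
  {E' H' M' : Type*} [NormedAddCommGroup E'] [NormedSpace ℝ E'] [TopologicalSpace H']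
  (I' : ModelWithCorners ℝ E' H') [TopologicalSpace M'] [ChartedSpace H' M']

/-- The space `⋀⁴ T_x M` of 4-vectors at `x`. -/
abbrev FourVector (x : M) := ⋀[ℝ]^4 (TangentSpace I x)

/-- The map `f_* : ⋀⁴ T_x M → ⋀⁴ T_{f x} M'` induced by the derivative of `f` at `x`. -/
def fourPush (f : M → M') (x : M) : FourVector I x →ₗ[ℝ] FourVector I' (f x) :=
  exteriorPower.map 4 (mfderiv I I' f x).toLinearMap

variable {I I'}

/-- The 4-vector field `μ` on the Lie group `M` is multiplicative. -/
def IsMultiplicativeField [Mul M] (μ : ∀ g : M, FourVector I g) : Prop :=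
  ∀ g h : M, μ (g * h) =
    fourPush I I (fun k => g * k) h (μ h) + fourPush I I (fun k => k * h) g (μ g)

/-- The smooth action map `β : M × M' → M'` of a Lie group `M` is multiplicative with respect to the
4-vector field `μ ⊕ ξ`, where `μ` is multiplicative:
`ξ (β h x) = (β h ·)_* ξ x + (β · x)_* μ h`. -/
structure IsMultiplicativeAction [Mul M] (β : M → M' → M') (μ : ∀ g : M, FourVector I g)
    (ξ : ∀ x : M', FourVector I' x) : Prop where
  contMDiff : ContMDiff (I.prod I') I' ∞ (fun p : M × M' => β p.1 p.2)
  isMultiplicativeField : IsMultiplicativeField μ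
  map_eq : ∀ (h : M) (x : M'), ξ (β h x) =
    fourPush I' I' (fun y => β h y) x (ξ x) + fourPush I I' (fun k => β k x) h (μ h)

end FourVectors

section Bruhat

variable (n : ℕ)

/-- The element of `𝔰𝔭(n)` with `(p, q)` entry `a`, `(q, p)` entry `-a⋆` and zeros elsewhere
(for `p ≠ q`): it is `E^{p,q}` for `a = 1` and `S_a^{p,q}` for `a` one of `i`, `j`, `k`. -/
def rootVector (p q : Fin n) (a : ℍ[ℝ]) : SkewAdj (QMat n) :=
  ⟨Matrix.single p q a - Matrix.single q p (star a), by
    change star _ = -_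
    rw [Matrix.star_eq_conjTranspose, Matrix.conjTranspose_sub, Matrix.conjTranspose_single,
      Matrix.conjTranspose_single, star_star, neg_sub]⟩

/-- A skew-adjoint matrix as a tangent vector of `Sp(n)` at the identity. -/
def toTangent (X : SkewAdj (QMat n)) : TangentSpace 𝓘(ℝ, SkewAdj (QMat n)) (1 : Sp n) := X

lemma mfderiv_coe_toTangent (X : SkewAdj (QMat n)) :
    mfderiv 𝓘(ℝ, SkewAdj (QMat n)) 𝓘(ℝ, QMat n) (fun u : Sp n => (u : QMat n)) 1
      (toTangent n X) = (X : QMat n) := by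
  rw [mfderiv_unitary_coe_one]; rfl

/-- The 4-vector `Λ = ∑_{p < q} E^{p,q} ∧ S_i^{p,q} ∧ S_j^{p,q} ∧ S_k^{p,q}` at the identity. -/
def Lambda : FourVector 𝓘(ℝ, SkewAdj (QMat n)) (1 : Sp n) :=
  ∑ p : Fin n, ∑ q ∈ Finset.Ioi p,
    exteriorPower.ιMulti ℝ 4 ![toTangent n (rootVector n p q 1),
      toTangent n (rootVector n p q ⟨0, 1, 0, 0⟩), toTangent n (rootVector n p q ⟨0, 0, 1, 0⟩),
      toTangent n (rootVector n p q ⟨0, 0, 0, 1⟩)]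

/-- The left invariant 4-vector field with value `Λ` at the identity. -/
def LambdaL (g : Sp n) : FourVector 𝓘(ℝ, SkewAdj (QMat n)) g :=
  fourPush 𝓘(ℝ, SkewAdj (QMat n)) 𝓘(ℝ, SkewAdj (QMat n)) (fun k => g * k) 1 (Lambda n)

/-- The right invariant 4-vector field with value `Λ` at the identity. -/
def LambdaR (g : Sp n) : FourVector 𝓘(ℝ, SkewAdj (QMat n)) g :=
  fourPush 𝓘(ℝ, SkewAdj (QMat n)) 𝓘(ℝ, SkewAdj (QMat n)) (fun k => k * g) 1 (Lambda n)

/-- The 4-vector field `π = Λ^L - Λ^R` on `Sp(n)`. -/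
def spField (g : Sp n) : FourVector 𝓘(ℝ, SkewAdj (QMat n)) g := LambdaL n g - LambdaR n g

/-- The Bruhat 4-vector field on `Sph \ Sp(n)`: the image of `π` at a representative. -/
def bruhatField (x : FlagManifold n) : FourVector 𝓘(ℝ, FlagModel n) x :=
  fourPush 𝓘(ℝ, SkewAdj (QMat n)) 𝓘(ℝ, FlagModel n) (RightCosets.mk (Sph n)) (Quotient.out x)
    (spField n (Quotient.out x))

/-- The Bruhat 4-vector field on `Sp(n) / Sph`: the image of `π` at a representative. -/
def bruhatFieldLeft (x : LeftFlagManifold n) : FourVector 𝓘(ℝ, FlagModel n) x :=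
  fourPush 𝓘(ℝ, SkewAdj (QMat n)) 𝓘(ℝ, FlagModel n) (QuotientGroup.mk : Sp n → LeftFlagManifold n)
    (Quotient.out x) (spField n (Quotient.out x))

end Bruhat

end

/-! Everything rests on the invariance of `Λ` under conjugation by `Sph`. The skew-adjoint matrices
supported at the positions `(p, q)` and `(q, p)`, `p ≠ q`, form a copy of `ℍ` via `rootVector`, and
conjugation by `diag(d)` acts on it as `a ↦ d_p a d_q⋆`. Left and right multiplication by a
quaternion `a` both have real determinant `|a|⁴`, so for unit quaternions this map has determinant
`1` and fixes the top-degree element `1 ∧ i ∧ j ∧ k`. Each summand of `Λ` is the image of that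
element, so `Λ` is fixed summand by summand (`map_conjTangent_Lambda`). Since left translation by
`s` is conjugation by `s` followed by right translation by `s`, the fields `Λ^L` and `Λ^R` agree on
`Sph`, so `π` vanishes there (`spField_eq_zero`).

Multiplicativity of `π` holds for any 4-vector in place of `Λ` (`isMultiplicativeField_sub`): in
`(L_g)_* π(h) + (R_h)_* π(g)` the two invariant terms give `π(gh)`, and the two mixed terms are both
the image of `Λ` under `k ↦ g k h`, with opposite signs.

A multiplicative field that vanishes at `s` satisfies `π(sg) = (L_s)_* π(g)` and `π(gs) = (R_s)_*
π(g)`. As the projections absorb translation by `s ∈ Sph` on the appropriate side, the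
pushed-forward value does not depend on the representative (`fourPush_eq_of_mul_left`,
`fourPush_eq_of_mul_right`). Pushing the multiplicativity identity of `π` forward to the quotient
then gives the identity for the action, because translation commutes with the projection and every
orbit map is a group translation followed by the projection (`isMultiplicativeAction_right`,
`isMultiplicativeAction_left`). The actions are smooth because the projections have smooth local
sections. -/

/-! ### Determinants of quaternion multiplications -/

section Determinant

/-- An alternating map in as many variables as the dimension is determined by its value on a
basis. -/
lemma alternatingMap_eq_det_smul {R M N ι : Type*} [CommRing R] [AddCommGroup M] [Module R M]
    [AddCommGroup N] [Module R N] [Fintype ι] [DecidableEq ι] (e : Module.Basis ι R M)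
    (g : M [⋀^ι]→ₗ[R] N) (v : ι → M) : g v = e.det v • g e := by
  have key : g = (LinearMap.toSpanSingleton R N (g e)).compAlternatingMap e.det := by
    -- It suffices to compare on injective families of basis vectors. An injective self-map of a
    -- finite index set is a permutation, and both sides change by its sign.
    refine e.ext_alternating fun w hw => ?_
    obtain ⟨σ, rfl⟩ : ∃ σ : Equiv.Perm ι, w = σ :=
      ⟨Equiv.ofBijective w (Finite.injective_iff_bijective.1 hw), rfl⟩
    change g (e ∘ σ) = e.det (e ∘ σ) • g e
    rw [g.map_perm, e.det.map_perm, e.det_self]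
    simp
  exact congrArg (fun f => f v) key

/-- The standard basis `1, i, j, k` of the quaternions. -/
noncomputable abbrev quatBasis : Module.Basis (Fin 4) ℝ ℍ[ℝ] :=
  QuaternionAlgebra.basisOneIJK (-1 : ℝ) 0 (-1)

lemma coe_quatBasis :
    (quatBasis : Fin 4 → ℍ[ℝ]) = ![1, ⟨0, 1, 0, 0⟩, ⟨0, 0, 1, 0⟩, ⟨0, 0, 0, 1⟩] := by
  funext i
  apply quatBasis.repr.injective
  rw [Module.Basis.repr_self]
  ext j
  change _ = (![_, _, _, _] : Fin 4 → ℝ) j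
  fin_cases i <;> fin_cases j <;> simp

/-- The value is `|a|⁴`, hence exactly `1`, and not merely `±1`, for a unit quaternion. It is
computed by expanding the matrix in the basis `1, i, j, k`. -/
lemma det_mulLeft_quaternion (a : ℍ[ℝ]) :
    LinearMap.det (LinearMap.mulLeft ℝ a) = (a.re ^ 2 + a.imI ^ 2 + a.imJ ^ 2 + a.imK ^ 2) ^ 2 := by
  have h : LinearMap.toMatrix quatBasis quatBasis (LinearMap.mulLeft ℝ a) =
      !![a.re, -a.imI, -a.imJ, -a.imK; a.imI, a.re, -a.imK, a.imJ;
        a.imJ, a.imK, a.re, -a.imI; a.imK, -a.imJ, a.imI, a.re] := by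
    ext i j
    rw [LinearMap.toMatrix_apply, coe_quatBasis]
    -- The family is hidden behind `y` so that the component formulas of a product are applied to an
    -- unevaluated `y j`. Its entries come back only afterwards.
    obtain ⟨y, hy⟩ : ∃ y : Fin 4 → ℍ[ℝ], y =
      ![1, ⟨0, 1, 0, 0⟩, ⟨0, 0, 1, 0⟩, ⟨0, 0, 0, 1⟩] := ⟨_, rfl⟩
    rw [← hy]
    change (![(a * y j).re, (a * y j).imI, (a * y j).imJ, (a * y j).imK] : Fin 4 → ℝ) i = _
    rw [Quaternion.re_mul, Quaternion.imI_mul, Quaternion.imJ_mul, Quaternion.imK_mul, hy]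
    fin_cases i <;> fin_cases j <;> simp
  rw [← LinearMap.det_toMatrix quatBasis, h]
  simp [Matrix.det_succ_row_zero, Fin.sum_univ_succ, Fin.succAbove]
  ring

/-- Compared with left multiplication, only the off-diagonal signs of the imaginary `3 × 3` block
are reversed, and the determinant is the same. -/
lemma det_mulRight_quaternion (a : ℍ[ℝ]) :
    LinearMap.det (LinearMap.mulRight ℝ a) = (a.re ^ 2 + a.imI ^ 2 + a.imJ ^ 2 + a.imK ^ 2) ^ 2 := by
  have h : LinearMap.toMatrix quatBasis quatBasis (LinearMap.mulRight ℝ a) =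
      !![a.re, -a.imI, -a.imJ, -a.imK; a.imI, a.re, a.imK, -a.imJ;
        a.imJ, -a.imK, a.re, a.imI; a.imK, a.imJ, -a.imI, a.re] := by
    ext i j
    rw [LinearMap.toMatrix_apply, coe_quatBasis]
    obtain ⟨y, hy⟩ : ∃ y : Fin 4 → ℍ[ℝ], y =
      ![1, ⟨0, 1, 0, 0⟩, ⟨0, 0, 1, 0⟩, ⟨0, 0, 0, 1⟩] := ⟨_, rfl⟩
    rw [← hy]
    change (![(y j * a).re, (y j * a).imI, (y j * a).imJ, (y j * a).imK] : Fin 4 → ℝ) i = _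
    rw [Quaternion.re_mul, Quaternion.imI_mul, Quaternion.imJ_mul, Quaternion.imK_mul, hy]
    fin_cases i <;> fin_cases j <;> simp
  rw [← LinearMap.det_toMatrix quatBasis, h]
  simp [Matrix.det_succ_row_zero, Fin.sum_univ_succ, Fin.succAbove]
  ring

lemma sum_sq_of_mem_unitary {a : ℍ[ℝ]} (ha : a ∈ unitary ℍ[ℝ]) :
    a.re ^ 2 + a.imI ^ 2 + a.imJ ^ 2 + a.imK ^ 2 = 1 := by
  rw [← Quaternion.normSq_def']
  have h := Quaternion.self_mul_star a
  rw [ha.2] at h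
  exact Quaternion.coe_injective (h.symm.trans Quaternion.coe_one.symm)

/-- For unit quaternions `a` and `b`, the map `x ↦ a x b` does not change `1 ∧ i ∧ j ∧ k`. -/
lemma alternatingMap_quaternion_unitary {N : Type*} [AddCommGroup N] [Module ℝ N]
    (g : ℍ[ℝ] [⋀^Fin 4]→ₗ[ℝ] N) {a b : ℍ[ℝ]} (ha : a ∈ unitary ℍ[ℝ]) (hb : b ∈ unitary ℍ[ℝ]) :
    g (fun i => a * (quatBasis i * b)) = g quatBasis := by
  rw [alternatingMap_eq_det_smul quatBasis]
  -- By multiplicativity this determinant is `|a|⁴ |b|⁴`.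
  have h : quatBasis.det (fun i => a * (quatBasis i * b)) = 1 := by
    have := quatBasis.det_comp (LinearMap.mulLeft ℝ a ∘ₗ LinearMap.mulRight ℝ b) quatBasis
    rw [LinearMap.det_comp, det_mulLeft_quaternion, det_mulRight_quaternion,
      sum_sq_of_mem_unitary ha, sum_sq_of_mem_unitary hb, Module.Basis.det_self] at this
    rw [one_pow, mul_one, mul_one] at this
    exact this
  rw [h, one_smul]

/-- A sum of terms `f p q 1 ∧ f p q i ∧ f p q j ∧ f p q k` is fixed by a linear map which multiplies
the quaternions on both sides by unit quaternions. -/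
lemma exteriorPower_map_sum_quaternion {m : ℕ} {V : Type*} [AddCommGroup V] [Module ℝ V]
    (f : Fin m → Fin m → ℍ[ℝ] →ₗ[ℝ] V) (T : V →ₗ[ℝ] V) (d : Fin m → unitary ℍ[ℝ])
    (hT : ∀ p q a, T (f p q a) = f p q ((d p : ℍ[ℝ]) * (a * star (d q : ℍ[ℝ])))) :
    exteriorPower.map 4 T (∑ p : Fin m, ∑ q ∈ Finset.Ioi p,
        exteriorPower.ιMulti ℝ 4 fun i => f p q (quatBasis i)) =
      ∑ p : Fin m, ∑ q ∈ Finset.Ioi p, exteriorPower.ιMulti ℝ 4 fun i => f p q (quatBasis i) := by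
  rw [map_sum]
  refine Finset.sum_congr rfl fun p _ => ?_
  rw [map_sum]
  refine Finset.sum_congr rfl fun q _ => ?_
  rw [exteriorPower.map_apply_ιMulti]
  -- Pulled back along `f p q`, the wedge product is an alternating map on `ℍ` itself, to which the
  -- determinant computation applies.
  have h := alternatingMap_quaternion_unitary
    ((exteriorPower.ιMulti ℝ 4).compLinearMap (f p q)) (d p).2 (Unitary.star_mem (d q).2)
  refine Eq.trans (congrArg (exteriorPower.ιMulti ℝ 4) ?_) h
  funext i
  exact hT p q (quatBasis i)

end Determinant

/-! ### Functoriality of the pushforward of 4-vectors -/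

section Functoriality

variable {E H M : Type*} [NormedAddCommGroup E] [NormedSpace ℝ E] [TopologicalSpace H]
  {I : ModelWithCorners ℝ E H} [TopologicalSpace M] [ChartedSpace H M]
  {E' H' M' : Type*} [NormedAddCommGroup E'] [NormedSpace ℝ E'] [TopologicalSpace H']
  {I' : ModelWithCorners ℝ E' H'} [TopologicalSpace M'] [ChartedSpace H' M']
  {E'' H'' M'' : Type*} [NormedAddCommGroup E''] [NormedSpace ℝ E''] [TopologicalSpace H'']
  {I'' : ModelWithCorners ℝ E'' H''} [TopologicalSpace M''] [ChartedSpace H'' M'']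

/-- This is the chain rule followed by functoriality of the exterior power. The composite `h` and
the intermediate point `y` are kept free, with equations as hypotheses, so that base points such as
`g * 1` and `g` need no transport; the statement is well typed because every tangent space is by
definition the model space. -/
lemma fourPush_fourPush (g : M' → M'') (f : M → M') (h : M → M'') (hh : ∀ x, g (f x) = h x) {x : M}
    {y : M'} (hy : f x = y) (hg : MDifferentiableAt I' I'' g y) (hf : MDifferentiableAt I I' f x)
    (w : FourVector I x) :
    fourPush I' I'' g y (fourPush I I' f x w) = fourPush I I'' h x w := by
  obtain rfl : g ∘ f = h := funext hh
  subst hy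
  unfold fourPush
  rw [mfderiv_comp x hg hf]
  exact (LinearMap.congr_fun (exteriorPower.map_comp (n := 4) (mfderiv I I' f x).toLinearMap
    (mfderiv I' I'' g (f x)).toLinearMap) w).symm

variable (I) in
/-- The canonical identification of the model space with the tangent space at `x`. -/
def tangentOfModel (x : M) : E →ₗ[ℝ] TangentSpace I x := LinearMap.id

end Functoriality

/-! ### Invariant and multiplicative 4-vector fields on a Lie group -/

section LieGroupFields

variable {E H G : Type*} [NormedAddCommGroup E] [NormedSpace ℝ E] [TopologicalSpace H]
  {I : ModelWithCorners ℝ E H} [TopologicalSpace G] [ChartedSpace H G] [Group G] [LieGroup I ∞ G]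
  {E' H' Q : Type*} [NormedAddCommGroup E'] [NormedSpace ℝ E'] [TopologicalSpace H']
  {I' : ModelWithCorners ℝ E' H'} [TopologicalSpace Q] [ChartedSpace H' Q]

variable (I) in
lemma mdifferentiable_leftTranslation (g : G) : MDifferentiable I I (fun k : G => g * k) :=
  (contMDiff_mul_left (n := ∞)).mdifferentiable (by simp)

variable (I) in
lemma mdifferentiable_rightTranslation (g : G) : MDifferentiable I I (fun k : G => k * g) :=
  (contMDiff_mul_right (n := ∞)).mdifferentiable (by simp)

/-- The left invariant 4-vector field with value `w` at the identity. -/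
noncomputable def leftInvariantField (w : FourVector I (1 : G)) (g : G) : FourVector I g :=
  fourPush I I (fun k => g * k) 1 w

/-- The right invariant 4-vector field with value `w` at the identity. -/
noncomputable def rightInvariantField (w : FourVector I (1 : G)) (g : G) : FourVector I g :=
  fourPush I I (fun k => k * g) 1 w

/-- The difference of a left and a right invariant field is multiplicative. -/
theorem isMultiplicativeField_sub (w : FourVector I (1 : G)) :
    IsMultiplicativeField fun g => leftInvariantField w g - rightInvariantField w g := by
  intro g h
  have e1 : fourPush I I (fun k : G => g * k) h (leftInvariantField w h) =
      leftInvariantField w (g * h) :=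
    fourPush_fourPush (fun k : G => g * k) (fun k : G => h * k) (fun k : G => g * h * k)
      (fun k => (mul_assoc g h k).symm) (mul_one h)
      (mdifferentiable_leftTranslation I g h) (mdifferentiable_leftTranslation I h 1) _
  have e2 : fourPush I I (fun k : G => k * h) g (rightInvariantField w g) =
      rightInvariantField w (g * h) :=
    fourPush_fourPush (fun k : G => k * h) (fun k : G => k * g) (fun k : G => k * (g * h))
      (fun k => mul_assoc k g h) (one_mul g)
      (mdifferentiable_rightTranslation I h g) (mdifferentiable_rightTranslation I g 1) _
  -- The two mixed terms are both the image of `w` under `k ↦ g k h`, and they cancel in the sum.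
  have e3 : (fourPush I I (fun k : G => g * k) h (rightInvariantField w h) :
      FourVector I (g * h)) = fourPush I I (fun k : G => g * k * h) 1 w :=
    fourPush_fourPush (fun k : G => g * k) (fun k : G => k * h) (fun k : G => g * k * h)
      (fun k => (mul_assoc g k h).symm) (one_mul h)
      (mdifferentiable_leftTranslation I g h) (mdifferentiable_rightTranslation I h 1) _
  have e4 : (fourPush I I (fun k : G => k * h) g (leftInvariantField w g) :
      FourVector I (g * h)) = fourPush I I (fun k : G => g * k * h) 1 w :=
    fourPush_fourPush (fun k : G => k * h) (fun k : G => g * k) (fun k : G => g * k * h)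
      (fun k => rfl) (mul_one g)
      (mdifferentiable_rightTranslation I h g) (mdifferentiable_leftTranslation I g 1) _
  rw [map_sub, map_sub, e1, e2, e3, e4]
  exact (sub_add_sub_cancel _ _ _).symm

/-- The left and right invariant fields with value `w` at the identity agree at `s` if `w` is
invariant under conjugation by `s`. -/
theorem leftInvariantField_eq_right {s : G} {w : FourVector I (1 : G)}
    {T : TangentSpace I (1 : G) →L[ℝ] TangentSpace I (1 : G)}
    (hT : HasMFDerivAt I I (fun k : G => s * k * s⁻¹) 1 T)
    (hw : exteriorPower.map 4 T.toLinearMap w = w) :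
    leftInvariantField w s = rightInvariantField w s := by
  have hc : fourPush I I (fun k : G => s * k * s⁻¹) 1 w = w := by
    unfold fourPush
    rw [hT.mfderiv]
    exact hw
  -- The factorisation used is `s k = (s k s⁻¹) s`, where conjugation fixes the identity.
  have h := fourPush_fourPush (I := I) (I' := I) (I'' := I) (fun k : G => k * s)
    (fun k : G => s * k * s⁻¹) (fun k : G => s * k)
    (fun k => inv_mul_cancel_right _ _) (x := 1) (y := 1) (by simp)
    (mdifferentiable_rightTranslation I s 1) hT.mdifferentiableAt w
  exact h.symm.trans (congrArg (fourPush I I (fun k : G => k * s) 1) hc)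

/-! ### Descent to a quotient and multiplicativity of the induced action -/

variable {μ : ∀ g : G, FourVector I g} {p : G → Q} {ξ : ∀ x : Q, FourVector I' x}

/-- A multiplicative field descends along `p` if any two elements in a fibre of `p` differ by left
multiplication by some `s` such that the field vanishes at `s` and `p` is invariant under left
translation by `s`. -/
theorem fourPush_eq_of_mul_left (hμ : IsMultiplicativeField μ) (hp : MDifferentiable I I' p)
    {σ : Q → G} {g : G} (hσ : ∃ s, σ (p g) = s * g ∧ μ s = 0 ∧ ∀ k, p (s * k) = p k) :
    (fourPush I I' p (σ (p g)) (μ (σ (p g))) : FourVector I' (p g)) = fourPush I I' p g (μ g) := by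
  obtain ⟨s, hs, hs0, hps⟩ := hσ
  -- Since `μ s = 0`, only one term of the multiplicativity identity survives, and `p` absorbs the
  -- remaining translation.
  have h : μ (s * g) = fourPush I I (fun k : G => s * k) g (μ g) := by
    rw [hμ s g, hs0, map_zero, add_zero]
  rw [hs, h]
  exact fourPush_fourPush p (fun k : G => s * k) p hps rfl (hp _)
    (mdifferentiable_leftTranslation I s g) _

/-- A multiplicative field descends along `p` if any two elements in a fibre of `p` differ by right
multiplication by some `s` such that the field vanishes at `s` and `p` is invariant under right
translation by `s`. -/
theorem fourPush_eq_of_mul_right (hμ : IsMultiplicativeField μ) (hp : MDifferentiable I I' p)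
    {σ : Q → G} {g : G} (hσ : ∃ s, σ (p g) = g * s ∧ μ s = 0 ∧ ∀ k, p (k * s) = p k) :
    (fourPush I I' p (σ (p g)) (μ (σ (p g))) : FourVector I' (p g)) = fourPush I I' p g (μ g) := by
  obtain ⟨s, hs, hs0, hps⟩ := hσ
  have h : μ (g * s) = fourPush I I (fun k : G => k * s) g (μ g) := by
    rw [hμ g s, hs0, map_zero, zero_add]
  rw [hs, h]
  exact fourPush_fourPush p (fun k : G => k * s) p hps rfl (hp _)
    (mdifferentiable_rightTranslation I s g) _

/-- The right translation action on a quotient is multiplicative for the field induced by a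
multiplicative field on the group. -/
theorem isMultiplicativeAction_right {β : G → Q → Q} (hμ : IsMultiplicativeField μ)
    (hp : MDifferentiable I I' p) (hsurj : Function.Surjective p)
    (hξ : ∀ g, ξ (p g) = fourPush I I' p g (μ g))
    (hβ : ContMDiff (I.prod I') I' ∞ (fun x : G × Q => β x.1 x.2))
    (hβp : ∀ h u, β h (p u) = p (u * h)) : IsMultiplicativeAction β μ ξ where
  contMDiff := hβ
  isMultiplicativeField := hμ
  map_eq h x := by
    obtain ⟨u, rfl⟩ := hsurj x
    have d1 : MDifferentiable I' I' (β h) :=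
      (hβ.comp (contMDiff_const.prodMk contMDiff_id)).mdifferentiable (by simp)
    -- Both sides are the image of `μ u` under `k ↦ p (k h)`, as `β h` intertwines `p` with right
    -- translation.
    have e1 : (fourPush I' I' (β h) (p u) (fourPush I I' p u (μ u)) : FourVector I' (p (u * h))) =
        fourPush I I' p (u * h) (fourPush I I (fun k : G => k * h) u (μ u)) :=
      (fourPush_fourPush (β h) p (fun k => p (k * h))
        (hβp h) rfl (d1 _) (hp u) _).trans
        (fourPush_fourPush p (fun k : G => k * h) (fun k => p (k * h))
          (fun _ => rfl) rfl (hp _)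
          (mdifferentiable_rightTranslation I h u) _).symm
    -- The orbit map of `p u` is left translation by `u` followed by `p`.
    have e2 : (fourPush I I' (fun k : G => β k (p u)) h (μ h) : FourVector I' (p (u * h))) =
        fourPush I I' p (u * h) (fourPush I I (fun k : G => u * k) h (μ h)) :=
      (fourPush_fourPush p (fun k : G => u * k) (fun k => β k (p u))
        (fun k => (hβp k u).symm) rfl (hp _)
        (mdifferentiable_leftTranslation I u h) _).symm
    have e3 := hξ (u * h)
    -- For a right action the product is `u * h`, so the term carrying `μ u` comes second in the
    -- group identity but first in the identity for the action.
    rw [hμ u h, map_add, add_comm] at e3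
    have e4 : ξ (β h (p u)) = ξ (p (u * h)) := by rw [hβp]
    rw [hξ u]
    exact e4.trans (e3.trans (congrArg₂ (· + ·) e1.symm e2.symm))

/-- The left translation action on a quotient is multiplicative for the field induced by a
multiplicative field on the group. -/
theorem isMultiplicativeAction_left {β : G → Q → Q} (hμ : IsMultiplicativeField μ)
    (hp : MDifferentiable I I' p) (hsurj : Function.Surjective p)
    (hξ : ∀ g, ξ (p g) = fourPush I I' p g (μ g))
    (hβ : ContMDiff (I.prod I') I' ∞ (fun x : G × Q => β x.1 x.2))
    (hβp : ∀ h u, β h (p u) = p (h * u)) : IsMultiplicativeAction β μ ξ where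
  contMDiff := hβ
  isMultiplicativeField := hμ
  map_eq h x := by
    obtain ⟨u, rfl⟩ := hsurj x
    have d1 : MDifferentiable I' I' (β h) :=
      (hβ.comp (contMDiff_const.prodMk contMDiff_id)).mdifferentiable (by simp)
    have e1 : (fourPush I' I' (β h) (p u) (fourPush I I' p u (μ u)) : FourVector I' (p (h * u))) =
        fourPush I I' p (h * u) (fourPush I I (fun k : G => h * k) u (μ u)) :=
      (fourPush_fourPush (β h) p (fun k => p (h * k))
        (hβp h) rfl (d1 _) (hp u) _).trans
        (fourPush_fourPush p (fun k : G => h * k) (fun k => p (h * k))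
          (fun _ => rfl) rfl (hp _)
          (mdifferentiable_leftTranslation I h u) _).symm
    have e2 : (fourPush I I' (fun k : G => β k (p u)) h (μ h) : FourVector I' (p (h * u))) =
        fourPush I I' p (h * u) (fourPush I I (fun k : G => k * u) h (μ h)) :=
      (fourPush_fourPush p (fun k : G => k * u) (fun k => β k (p u))
        (fun k => (hβp k u).symm) rfl (hp _)
        (mdifferentiable_rightTranslation I u h) _).symm
    have e3 := hξ (h * u)
    rw [hμ h u, map_add] at e3
    have e4 : ξ (β h (p u)) = ξ (p (h * u)) := by rw [hβp]
    rw [hξ u]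
    exact e4.trans (e3.trans (congrArg₂ (· + ·) e1.symm e2.symm))

end LieGroupFields

/-! ### The derivative of conjugation at the identity -/

section ConjugationDerivative

variable {A : Type*} [NormedRing A] [NormedAlgebra ℝ A] [StarRing A] [StarModule ℝ A]
  [ContinuousStar A]

/-- The linear map `X ↦ s X s⋆` on skew-adjoint elements. -/
noncomputable def conjSkewAdj (s : unitary A) : SkewAdj A →L[ℝ] SkewAdj A :=
  skewProj.comp (((ContinuousLinearMap.mul ℝ A (s : A)).comp
    ((ContinuousLinearMap.mul ℝ A).flip (star (s : A)))).comp (SkewAdj A).subtypeL)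

/-- The matrix `s X s⋆` is already skew-adjoint, so `skewProj` in the definition changes nothing and
serves only to provide the codomain. -/
lemma coe_conjSkewAdj (s : unitary A) (X : SkewAdj A) :
    (conjSkewAdj s X : A) = (s : A) * ((X : A) * star (s : A)) := by
  refine skewProj_of_star (x := (s : A) * ((X : A) * star (s : A))) ?_
  rw [star_mul, star_mul, star_star, skewAdj_star, mul_neg, neg_mul, mul_assoc]

variable [CompleteSpace A]

/-- The base point is a variable equal to `1` because it is needed at `s * 1 * s⁻¹`. -/
lemma hasMFDerivAt_unitary_coe {k : unitary A} (hk : k = 1) :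
    HasMFDerivAt 𝓘(ℝ, SkewAdj A) 𝓘(ℝ, A) (fun u : unitary A => (u : A)) k
      ((SkewAdj A).subtypeL) := by
  subst hk
  have h := ((contMDiff_unitary_coe (A := A)).mdifferentiable (by simp) 1).hasMFDerivAt
  rw [mfderiv_unitary_coe_one] at h
  exact h

/-- Conjugation by `s` has derivative `X ↦ s X s⋆` at the identity. -/
lemma hasMFDerivAt_conj (s : unitary A) :
    HasMFDerivAt 𝓘(ℝ, SkewAdj A) 𝓘(ℝ, SkewAdj A) (fun k : unitary A => s * k * s⁻¹) 1
      (conjSkewAdj s) := by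
  have hconj := (((mdifferentiable_rightTranslation 𝓘(ℝ, SkewAdj A) s⁻¹).comp
    (mdifferentiable_leftTranslation 𝓘(ℝ, SkewAdj A) s)) 1).hasMFDerivAt
  -- Smoothness gives some derivative `D`. To identify it, conjugation is composed with the
  -- inclusion into `A`, where it becomes the restriction of the linear map `T`; the inclusion has
  -- injective derivative, so `D` is determined.
  obtain ⟨D, hD⟩ : ∃ D : SkewAdj A →L[ℝ] SkewAdj A,
      HasMFDerivAt 𝓘(ℝ, SkewAdj A) 𝓘(ℝ, SkewAdj A)
        (fun k : unitary A => s * k * s⁻¹) 1 D := ⟨_, hconj⟩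
  let T : A →L[ℝ] A := (ContinuousLinearMap.mul ℝ A (s : A)).comp
    ((ContinuousLinearMap.mul ℝ A).flip (star (s : A)))
  have hT : ∀ Z, T Z = (s : A) * (Z * star (s : A)) := fun Z => rfl
  have e1 := HasMFDerivAt.comp (1 : unitary A) (hasMFDerivAt_unitary_coe (by simp)) hD
  have e2 := HasMFDerivAt.comp (1 : unitary A) T.hasMFDerivAt (hasMFDerivAt_unitary_coe rfl)
  have e3 : (fun k : unitary A => (k : A)) ∘ (fun k : unitary A => s * k * s⁻¹) =
      T ∘ fun k : unitary A => (k : A) := by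
    funext k
    change ((s * k * s⁻¹ : unitary A) : A) = T (k : A)
    rw [hT, Submonoid.coe_mul, Submonoid.coe_mul, mul_assoc]
    rfl
  rw [e3] at e1
  have e4 : (SkewAdj A).subtypeL.comp D = T.comp (SkewAdj A).subtypeL :=
    hasMFDerivAt_unique e1 e2
  have e5 : D = conjSkewAdj s := by
    ext1 X
    refine Subtype.ext (Eq.trans ?_ (coe_conjSkewAdj s X).symm)
    exact congrArg (fun f : SkewAdj A →L[ℝ] A => f X) e4
  rwa [← e5]

/-- The map `X ↦ s X s⋆` on the tangent space at the identity. -/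
noncomputable def conjTangent (s : unitary A) :
    TangentSpace 𝓘(ℝ, SkewAdj A) (1 : unitary A) →L[ℝ]
      TangentSpace 𝓘(ℝ, SkewAdj A) (1 : unitary A) :=
  conjSkewAdj s

end ConjugationDerivative

/-! ### Invariance of `Λ` under conjugation by `Sph` -/

section AdjointInvariance

variable {n : ℕ}

/-- The tangent vector of `Sp(n)` at the identity given by `rootVector`, as a linear map. -/
noncomputable def rootVectorLinear (p q : Fin n) :
    ℍ[ℝ] →ₗ[ℝ] TangentSpace 𝓘(ℝ, SkewAdj (QMat n)) (1 : Sp n) :=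
  tangentOfModel 𝓘(ℝ, SkewAdj (QMat n)) (1 : Sp n) ∘ₗ
  { toFun := rootVector n p q
    map_add' := fun a b => by
      apply Subtype.ext
      change Matrix.single p q (a + b) - Matrix.single q p (star (a + b)) =
        (Matrix.single p q a - Matrix.single q p (star a)) +
          (Matrix.single p q b - Matrix.single q p (star b))
      rw [star_add, Matrix.single_add, Matrix.single_add]
      abel
    map_smul' := fun r a => by
      apply Subtype.ext
      change Matrix.single p q (r • a) - Matrix.single q p (star (r • a)) =
        r • (Matrix.single p q a - Matrix.single q p (star a))
      rw [Quaternion.star_smul, smul_sub, Matrix.smul_single, Matrix.smul_single] }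

lemma diagonal_mul_single_mul_diagonal {R : Type*} [Semiring R] (p q : Fin n) (a : R)
    (d e : Fin n → R) : Matrix.diagonal d * Matrix.single p q a * Matrix.diagonal e =
      Matrix.single p q (d p * a * e q) := by
  ext i j
  rw [Matrix.mul_diagonal, Matrix.diagonal_mul, Matrix.single_apply, Matrix.single_apply]
  split_ifs with h
  · rw [h.1, h.2]
  · simp

/-- The left factor scales rows and the right factor scales columns; the entry at `(q, p)` follows
suit because the star reverses products. -/
lemma rootVector_conj_diagonal (p q : Fin n) (a : ℍ[ℝ]) (d : Fin n → ℍ[ℝ]) :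
    (rootVector n p q (d p * (a * star (d q))) : QMat n) =
      Matrix.diagonal d * (rootVector n p q a : QMat n) * star (Matrix.diagonal d) := by
  change Matrix.single p q (d p * (a * star (d q))) -
    Matrix.single q p (star (d p * (a * star (d q)))) =
      Matrix.diagonal d * (Matrix.single p q a - Matrix.single q p (star a)) *
        star (Matrix.diagonal d)
  rw [Matrix.star_eq_conjTranspose, Matrix.diagonal_conjTranspose, mul_sub, sub_mul,
    diagonal_mul_single_mul_diagonal, diagonal_mul_single_mul_diagonal]
  simp [mul_assoc]

lemma conjTangent_rootVectorLinear {s : Sp n} {d : Fin n → unitary ℍ[ℝ]}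
    (hd : (s : QMat n) = Matrix.diagonal fun i => (d i : ℍ[ℝ])) (p q : Fin n) (a : ℍ[ℝ]) :
    conjTangent s (rootVectorLinear p q a) =
      rootVectorLinear p q ((d p : ℍ[ℝ]) * (a * star (d q : ℍ[ℝ]))) := by
  refine Subtype.ext ((coe_conjSkewAdj s (rootVector n p q a)).trans ?_)
  rw [hd, ← mul_assoc]
  exact (rootVector_conj_diagonal p q a fun i => (d i : ℍ[ℝ])).symm

/-- Each summand is exhibited as the image of the basis `1, i, j, k` under one linear map from `ℍ`,
the form in which the determinant argument applies. -/
lemma Lambda_eq : Lambda n = ∑ p : Fin n, ∑ q ∈ Finset.Ioi p,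
    exteriorPower.ιMulti ℝ 4 fun i => rootVectorLinear p q (quatBasis i) := by
  unfold Lambda
  refine Finset.sum_congr rfl fun p _ => Finset.sum_congr rfl fun q _ => ?_
  refine congrArg (exteriorPower.ιMulti ℝ 4) ?_
  rw [coe_quatBasis]
  funext i
  fin_cases i <;> rfl

/-- `Λ` is invariant under conjugation by elements of `Sph`. -/
lemma map_conjTangent_Lambda {s : Sp n} (hs : s ∈ Sph n) :
    exteriorPower.map 4 (conjTangent s).toLinearMap (Lambda n) = Lambda n := by
  obtain ⟨d, hd⟩ := hs
  rw [Lambda_eq]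
  exact exteriorPower_map_sum_quaternion rootVectorLinear _ d (conjTangent_rootVectorLinear hd)

end AdjointInvariance

/-! ### Smooth local sections and smoothness of the translation actions -/

section SmoothAction

variable {A : Type*} [NormedRing A] [NormedAlgebra ℝ A] [StarRing A] [StarModule ℝ A]
  [ContinuousStar A] [CompleteSpace A]
  {S : Subgroup (unitary A)} {M : Type*} [NormedAddCommGroup M] [NormedSpace ℝ M]
  {ι : M →L[ℝ] SkewAdj A} {P : SkewAdj A →L[ℝ] M}

/-- The invertibility condition is open, so near `X` the default value in `cayleyU` plays no role
and the map agrees with `cayley`. -/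
lemma contMDiffAt_cayleyU {X : SkewAdj A} (hX : IsUnit (1 - (1 / 2 : ℝ) • (X : A))) :
    ContMDiffAt 𝓘(ℝ, SkewAdj A) 𝓘(ℝ, SkewAdj A) ∞ (cayleyU : SkewAdj A → unitary A) X := by
  apply contMDiffAt_unitary_of_coe
  have key : ContDiffAt ℝ ∞ (fun Y : SkewAdj A => cayley (Y : A)) X :=
    (contDiffAt_cayley hX).comp X (SkewAdj A).subtypeL.contDiff.contDiffAt
  refine (key.congr_of_eventuallyEq ?_).contMDiffAt
  filter_upwards [(cayleyChart (A := A)).open_target.mem_nhds hX] with Y hY using coe_cayleyU hY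

namespace IsSliceProj

/-- The projection to `S \ U` has smooth local sections. -/
theorem exists_local_section (h : IsSliceProj S ι P) (x : RightCosets S) :
    letI := h.chartedSpace
    ∃ σ : RightCosets S → unitary A, ContMDiffAt 𝓘(ℝ, M) 𝓘(ℝ, SkewAdj A) ∞ σ x ∧
      ∀ᶠ y in nhds x, RightCosets.mk S (σ y) = y := by
  let _ := h.chartedSpace
  have _ := h.isManifold
  obtain ⟨g, hg⟩ : ∃ g : unitary A, chartAt M x = h.chart g := ⟨_, rfl⟩
  have ht : ∀ y ∈ (chartAt M x).source, chartAt M x y ∈ h.baseChart.target := by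
    rw [hg]
    exact fun y hy => (h.chart g).map_source hy
  -- The inverse of the chart is `X ↦ S (cayleyU (ι X)) g`; dropping `S` lifts it to the group.
  refine ⟨fun y => cayleyU (ι (chartAt M x y)) * g, ?_, ?_⟩
  · have h1 : ContMDiffAt 𝓘(ℝ, M) 𝓘(ℝ, M) ∞ (chartAt M x) x := contMDiffAt_extChartAt
    have h2 : ContMDiffAt 𝓘(ℝ, M) 𝓘(ℝ, SkewAdj A) ∞ (fun y => ι (chartAt M x y)) x :=
      ContMDiffAt.comp x (g := ι) ι.contDiff.contDiffAt.contMDiffAt h1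
    have h3 := ContMDiffAt.comp x (g := (cayleyU : SkewAdj A → unitary A))
      (contMDiffAt_cayleyU (h.baseChart_symm (ht x (mem_chart_source M x))).1) h2
    exact h3.mul contMDiffAt_const
  · filter_upwards [(chartAt M x).open_source.mem_nhds (mem_chart_source M x)] with y hy
    rw [← RightCosets.transl_mk, ← (h.baseChart_symm (ht y hy)).2]
    have h4 := (chartAt M x).left_inv hy
    rw [hg] at h4 ⊢
    conv_rhs => rw [← h4]
    change _ = (h.baseChart.symm (h.chart g y)).transl g⁻¹⁻¹
    rw [inv_inv]

/-- The right translation action on `S \ U` is smooth. -/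
theorem contMDiff_transl (h : IsSliceProj S ι P) :
    letI := h.chartedSpace
    ContMDiff (𝓘(ℝ, SkewAdj A).prod 𝓘(ℝ, M)) 𝓘(ℝ, M) ∞
      (fun p : unitary A × RightCosets S => p.2.transl p.1) := by
  let _ := h.chartedSpace
  rintro ⟨u, x⟩
  obtain ⟨σ, hσ, hσ'⟩ := h.exists_local_section x
  have h1 : ContMDiffAt (𝓘(ℝ, SkewAdj A).prod 𝓘(ℝ, M)) 𝓘(ℝ, SkewAdj A) ∞
      (fun p : unitary A × RightCosets S => σ p.2) (u, x) :=
    ContMDiffAt.comp (u, x) (g := σ) hσ contMDiffAt_snd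
  -- Near `(u, x)` the action is `(g, y) ↦ S (σ y) g`, a composite of smooth maps.
  refine ((h.contMDiff_mk _).comp (u, x) (h1.mul contMDiffAt_fst)).congr_of_eventuallyEq ?_
  filter_upwards [(continuous_snd (X := unitary A)).continuousAt.eventually hσ'] with p hp
  change _ = RightCosets.mk S (σ p.2 * p.1)
  rw [← RightCosets.transl_mk, hp]

/-- The homeomorphism `u S ↦ S u⁻¹` is smooth. -/
theorem contMDiff_ofLeft (h : IsSliceProj S ι P) :
    letI := h.chartedSpace
    letI := h.chartedSpaceLeft
    ContMDiff 𝓘(ℝ, M) 𝓘(ℝ, M) ∞ (RightCosets.ofLeft S) := by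
  let _ := h.chartedSpace
  let _ := h.chartedSpaceLeft
  have _ := h.isManifold_left
  intro x
  have h0 : ContMDiffAt 𝓘(ℝ, M) 𝓘(ℝ, M) ∞ (extChartAt 𝓘(ℝ, M) x) x := contMDiffAt_extChartAt
  -- The charts of `U / S` are by definition pulled back along this homeomorphism.
  have h1 : extChartAt 𝓘(ℝ, M) (RightCosets.ofLeft S x) ∘ RightCosets.ofLeft S =
      extChartAt 𝓘(ℝ, M) x := rfl
  rw [contMDiffAt_iff_target, h1]
  exact ⟨(RightCosets.ofLeft S).continuous.continuousAt, h0⟩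

/-- The projection to `U / S` has smooth local sections. -/
theorem exists_local_section_left (h : IsSliceProj S ι P) (x : unitary A ⧸ S) :
    letI := h.chartedSpaceLeft
    ∃ σ : unitary A ⧸ S → unitary A, ContMDiffAt 𝓘(ℝ, M) 𝓘(ℝ, SkewAdj A) ∞ σ x ∧
      ∀ᶠ y in nhds x, (QuotientGroup.mk (σ y) : unitary A ⧸ S) = y := by
  let _ := h.chartedSpaceLeft
  let _ := h.chartedSpace
  obtain ⟨σ, hσ, hσ'⟩ := h.exists_local_section (RightCosets.ofLeft S x)
  have h1 : ContMDiffAt 𝓘(ℝ, M) 𝓘(ℝ, SkewAdj A) ∞ (fun y => σ (RightCosets.ofLeft S y)) x :=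
    ContMDiffAt.comp x (g := σ) hσ (h.contMDiff_ofLeft x)
  -- A section over right cosets, conjugated by inversion, is a section over left cosets.
  refine ⟨fun y => (σ (RightCosets.ofLeft S y))⁻¹, h1.inv, ?_⟩
  filter_upwards [(RightCosets.ofLeft S).continuous.continuousAt.eventually hσ'] with y hy
  have h2 := congrArg (RightCosets.ofLeft S).symm hy
  rw [Homeomorph.symm_apply_apply] at h2
  exact h2

/-- The left translation action on `U / S` is smooth. -/
theorem contMDiff_smul_left (h : IsSliceProj S ι P) :
    letI := h.chartedSpaceLeft
    ContMDiff (𝓘(ℝ, SkewAdj A).prod 𝓘(ℝ, M)) 𝓘(ℝ, M) ∞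
      (fun p : unitary A × (unitary A ⧸ S) => p.1 • p.2) := by
  let _ := h.chartedSpaceLeft
  rintro ⟨u, x⟩
  obtain ⟨σ, hσ, hσ'⟩ := h.exists_local_section_left x
  have h1 : ContMDiffAt (𝓘(ℝ, SkewAdj A).prod 𝓘(ℝ, M)) 𝓘(ℝ, SkewAdj A) ∞
      (fun p : unitary A × (unitary A ⧸ S) => σ p.2) (u, x) :=
    ContMDiffAt.comp (u, x) (g := σ) hσ contMDiffAt_snd
  refine ((h.contMDiff_mk_left _).comp (u, x) (contMDiffAt_fst.mul h1)).congr_of_eventuallyEq ?_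
  filter_upwards [(continuous_snd (X := unitary A)).continuousAt.eventually hσ'] with p hp
  exact (congrArg (fun y => p.1 • y) hp).symm

end IsSliceProj

end SmoothAction

/-! ### The Bruhat fields and their multiplicative actions -/

section Descent

variable {n : ℕ}

theorem isMultiplicativeField_spField : IsMultiplicativeField (spField n) :=
  isMultiplicativeField_sub (Lambda n)

/-- `π` vanishes on `Sph`. -/
lemma spField_eq_zero {s : Sp n} (hs : s ∈ Sph n) : spField n s = 0 :=
  sub_eq_zero.2 (leftInvariantField_eq_right (T := conjTangent s) (hasMFDerivAt_conj s)
    (map_conjTangent_Lambda hs))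

lemma mdifferentiable_flag_mk :
    MDifferentiable 𝓘(ℝ, SkewAdj (QMat n)) 𝓘(ℝ, FlagModel n) (RightCosets.mk (Sph n)) :=
  (contMDiff_flag_mk n).mdifferentiable (by simp)

lemma mdifferentiable_leftFlag_mk :
    MDifferentiable 𝓘(ℝ, SkewAdj (QMat n)) 𝓘(ℝ, FlagModel n)
      (QuotientGroup.mk : Sp n → LeftFlagManifold n) :=
  (contMDiff_leftFlag_mk n).mdifferentiable (by simp)

/-- The chosen representative of `Sph g` differs from `g` by a left factor in `Sph`, where `π`
vanishes. This is the input for the independence of `bruhatField` from the representative. -/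
lemma exists_out_flag_mk (g : Sp n) :
    ∃ s, Quotient.out (RightCosets.mk (Sph n) g) = s * g ∧ spField n s = 0 ∧
      ∀ k, RightCosets.mk (Sph n) (s * k) = RightCosets.mk (Sph n) k := by
  have hmk : RightCosets.mk (Sph n) g =
      RightCosets.mk (Sph n) (Quotient.out (RightCosets.mk (Sph n) g)) := (Quotient.out_eq _).symm
  refine ⟨_, (inv_mul_cancel_right _ g).symm, spField_eq_zero (RightCosets.mk_eq.1 hmk),
    fun k => (RightCosets.mk_eq.2 ?_).symm⟩
  rw [mul_inv_cancel_right]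
  exact RightCosets.mk_eq.1 hmk

/-- For left cosets the element of `Sph` relating `g` to the chosen representative is a right
factor. -/
lemma exists_out_leftFlag_mk (g : Sp n) :
    ∃ s, Quotient.out (QuotientGroup.mk g : LeftFlagManifold n) = g * s ∧ spField n s = 0 ∧
      ∀ k, (QuotientGroup.mk (k * s) : LeftFlagManifold n) = QuotientGroup.mk k := by
  have hmk : (QuotientGroup.mk g : LeftFlagManifold n) =
      QuotientGroup.mk (Quotient.out (QuotientGroup.mk g : LeftFlagManifold n)) :=
    (Quotient.out_eq _).symm
  refine ⟨_, (mul_inv_cancel_left g _).symm, spField_eq_zero (QuotientGroup.eq.1 hmk),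
    fun k => (QuotientGroup.eq.2 ?_).symm⟩
  rw [inv_mul_cancel_left]
  exact QuotientGroup.eq.1 hmk

/-- `π` descends to `Sph \ Sp(n)`. -/
theorem bruhatField_mk (g : Sp n) :
    bruhatField n (RightCosets.mk (Sph n) g) =
      fourPush 𝓘(ℝ, SkewAdj (QMat n)) 𝓘(ℝ, FlagModel n) (RightCosets.mk (Sph n)) g
        (spField n g) :=
  fourPush_eq_of_mul_left isMultiplicativeField_spField mdifferentiable_flag_mk
    (exists_out_flag_mk g)

/-- `π` descends to `Sp(n) / Sph`. -/
theorem bruhatFieldLeft_mk (g : Sp n) :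
    bruhatFieldLeft n (QuotientGroup.mk g) =
      fourPush 𝓘(ℝ, SkewAdj (QMat n)) 𝓘(ℝ, FlagModel n)
        (QuotientGroup.mk : Sp n → LeftFlagManifold n) g (spField n g) :=
  fourPush_eq_of_mul_right isMultiplicativeField_spField mdifferentiable_leftFlag_mk
    (exists_out_leftFlag_mk g)

theorem isMultiplicativeAction_transl :
    IsMultiplicativeAction (fun (g : Sp n) (x : FlagManifold n) => x.transl g)
      (spField n) (bruhatField n) :=
  isMultiplicativeAction_right isMultiplicativeField_spField mdifferentiable_flag_mk
    Quotient.exists_rep bruhatField_mk (isSliceProj_sph n).contMDiff_transl fun _ _ => rfl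

theorem isMultiplicativeAction_smul :
    IsMultiplicativeAction (fun (g : Sp n) (x : LeftFlagManifold n) => g • x)
      (spField n) (bruhatFieldLeft n) :=
  isMultiplicativeAction_left isMultiplicativeField_spField mdifferentiable_leftFlag_mk
    QuotientGroup.mk_surjective bruhatFieldLeft_mk (isSliceProj_sph n).contMDiff_smul_left
    fun _ _ => rfl

end Descent

theorem mainTheorem8 (n : ℕ) :
    ((∀ g : Sp n, bruhatField n (RightCosets.mk (Sph n) g) =
        fourPush 𝓘(ℝ, SkewAdj (QMat n)) 𝓘(ℝ, FlagModel n) (RightCosets.mk (Sph n)) g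
          (spField n g)) ∧
      IsMultiplicativeAction (fun (g : Sp n) (x : FlagManifold n) => x.transl g)
        (spField n) (bruhatField n)) ∧
    ((∀ g : Sp n, bruhatFieldLeft n (QuotientGroup.mk g) =
        fourPush 𝓘(ℝ, SkewAdj (QMat n)) 𝓘(ℝ, FlagModel n)
          (QuotientGroup.mk : Sp n → LeftFlagManifold n) g (spField n g)) ∧
      IsMultiplicativeAction (fun (g : Sp n) (x : LeftFlagManifold n) => g • x)
        (spField n) (bruhatFieldLeft n)) := by
  exact ⟨⟨bruhatField_mk, isMultiplicativeAction_transl⟩,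
    ⟨bruhatFieldLeft_mk, isMultiplicativeAction_smul⟩⟩
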